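/- Let $d,m\in\mathbb N=\{1,2,\dots\}$, let $K=\prod_{i=1}^d[a_i,b_i]\subset\mathbb R^d$ with $a_i<b_i$ be a closed rectangle, let $f:K\to\mathbb R^m$ be of class $C^2$, and let $M=\{(\alpha,f(\alpha)):\alpha\in K\}\subset\mathbb R^{n}$, where $n=d+m$. Write $e_1,\dots,e_d$ for the standard basis of $\mathbb R^d$. Suppose that at least one of the following holds: (1) $m<d-1$, and for Lebesgue-a.e. $\alpha\in K$ the linear map $f''(\alpha):\mathrm{Sym}^2\,\mathbb R^d\to\mathbb R^m$ induced by the second derivative, $uv\mapsto f''(\alpha)[u,v]$, is surjective; (2) $m<\binom{d+1}{2}$, and for Lebesgue-a.e. $\alpha\in K$ the matrix $\big(t\cdot f''(\alpha)[e_i,e_j]\big)_{1\le i,j\le d}$ has rank at least $2$ for every $t\in\mathbb R^m\setminus\{0\}$. Then $M$ is of strong Khinchin type for convergence. That is, for every function $\psi:\mathbb N\to[0,\infty)$ (monotonic or not) with $\sum_{q=1}^\infty\psi(q)^n<\infty$ and every $\theta\in\mathbb R^n$, the set of those $x\in M$ for which $\|qx-\theta\|<\psi(q)$ for infinitely many $q\in\mathbb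 N$ has measure zero with respect to the Lebesgue measure of $M$ (the $d$-dimensional Hausdorff measure). Here $\|y\|$ is the distance from $y\in\mathbb R^n$ to the nearest vector of $\mathbb Z^n$ in the max norm. -/

import Mathlib

open MeasureTheory
open scoped NNReal

noncomputable section

namespace KhinchinType

/-- The distance `‖x‖` from `x ∈ ℝⁿ` to the nearest integer vector, measured in the max norm
(the metric of the plain function space `Fin n → ℝ`). -/
def distInt {n : ℕ} (x : EuclideanSpace ℝ (Fin n)) : ℝ :=
  Metric.infDist (fun i => x i : Fin n → ℝ)
    (Set.range fun (p : Fin n → ℤ) (i : Fin n) => (p i : ℝ))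

/-- The set of `x ∈ ℝⁿ` such that `‖q x - θ‖ < ψ q` for infinitely many positive integers `q`. -/
def approxSet {n : ℕ} (ψ : ℕ → ℝ≥0) (θ : EuclideanSpace ℝ (Fin n)) :
    Set (EuclideanSpace ℝ (Fin n)) :=
  {x | {q : ℕ | 0 < q ∧ distInt ((q : ℝ) • x - θ) < ψ q}.Infinite}

/-- A `d`-dimensional manifold `M ⊆ ℝⁿ` is of strong Khinchin type for convergence if for every
`ψ` (monotonic or not) with `∑_{q ≥ 1} ψ(q)ⁿ < ∞` and every `θ`, the set `S(ψ, θ) ∩ M` is null for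
the Lebesgue (i.e. `d`-dimensional Hausdorff) measure of `M`. -/
def IsStrongKhinchinConvergence (d : ℕ) {n : ℕ} (M : Set (EuclideanSpace ℝ (Fin n))) : Prop :=
  ∀ ψ : ℕ → ℝ≥0, Summable (fun q : ℕ => ψ (q + 1) ^ n) →
    ∀ θ : EuclideanSpace ℝ (Fin n), Measure.hausdorffMeasure (d : ℝ) (approxSet ψ θ ∩ M) = 0

/-- The closed rectangle `∏ᵢ [a i, b i]` in `ℝᵈ`. -/
def closedRect {d : ℕ} (a b : Fin d → ℝ) : Set (EuclideanSpace ℝ (Fin d)) :=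
  {x | ∀ i, a i ≤ x i ∧ x i ≤ b i}

/-- The graph `{(α, f α) : α ∈ K} ⊆ ℝ^(d+m)`. -/
def graphOver {d m : ℕ} (K : Set (EuclideanSpace ℝ (Fin d)))
    (f : EuclideanSpace ℝ (Fin d) → EuclideanSpace ℝ (Fin m)) :
    Set (EuclideanSpace ℝ (Fin (d + m))) :=
  {x | ∃ α ∈ K, x = WithLp.toLp 2 (Fin.append (fun i => α i) (fun j => f α j))}

/-- The second derivative `f''(α)` within `K`, as a bilinear map: `secondDeriv K f α u v` is
`f''(α)[u, v]`. -/
def secondDeriv {d m : ℕ} (K : Set (EuclideanSpace ℝ (Fin d)))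
    (f : EuclideanSpace ℝ (Fin d) → EuclideanSpace ℝ (Fin m)) (α : EuclideanSpace ℝ (Fin d)) :
    EuclideanSpace ℝ (Fin d) →L[ℝ] EuclideanSpace ℝ (Fin d) →L[ℝ] EuclideanSpace ℝ (Fin m) :=
  fderivWithin ℝ (fderivWithin ℝ f K) K α

/-- The `i`-th standard basis vector of `ℝᵈ`. -/
def stdVec {d : ℕ} (i : Fin d) : EuclideanSpace ℝ (Fin d) := EuclideanSpace.single i 1

/-- `Sym² ℝᵈ`, as the space of real symmetric `d × d` matrices; the product `u v` is
the matrix `(u vᵀ + v uᵀ) / 2`. -/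
def SymSq (d : ℕ) : Submodule ℝ (Matrix (Fin d) (Fin d) ℝ) where
  carrier := {B | B.IsSymm}
  add_mem' hA hB := Matrix.IsSymm.add hA hB
  zero_mem' := Matrix.isSymm_zero
  smul_mem' c _ hB := Matrix.IsSymm.smul hB c

/-- The linear map `f''(α) : Sym² ℝᵈ → ℝᵐ`, which for a symmetric `f''(α)` is the one
with `u v ↦ f''(α)[u, v]`. -/
def secondDerivSym {d m : ℕ} (K : Set (EuclideanSpace ℝ (Fin d)))
    (f : EuclideanSpace ℝ (Fin d) → EuclideanSpace ℝ (Fin m)) (α : EuclideanSpace ℝ (Fin d)) :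
    SymSq d →ₗ[ℝ] EuclideanSpace ℝ (Fin m) where
  toFun B := ∑ i, ∑ j, B.1 i j • secondDeriv K f α (stdVec i) (stdVec j)
  map_add' A B := by
    simp [add_smul, Finset.sum_add_distrib]
  map_smul' c B := by
    simp [mul_smul, Finset.smul_sum]

/-- The symmetric matrix `(t · f''(α)[eᵢ, eⱼ])_{i,j}`. -/
def dotSecondDeriv {d m : ℕ} (K : Set (EuclideanSpace ℝ (Fin d)))
    (f : EuclideanSpace ℝ (Fin d) → EuclideanSpace ℝ (Fin m)) (α : EuclideanSpace ℝ (Fin d))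
    (t : EuclideanSpace ℝ (Fin m)) : Matrix (Fin d) (Fin d) ℝ :=
  Matrix.of fun i j => inner ℝ t (secondDeriv K f α (stdVec i) (stdVec j))

end KhinchinType

end

/-! Both cases are instances of one criterion: for almost every α, every form t · f''(α) with t ≠ 0
has rank at least ρ, where 2m + ρ < ρ(d + m). Surjectivity of f'' gives ρ = 1, and the inequality
reads m < d - 1. In the second case ρ = 2, and it reads d ≥ 2.

The core is `exists_volume_closeSet_le`: near a good point, the α with ‖qα - θ‖ < δ and ‖q f(α) - η‖
< δ have volume O(δ^(d+m)), provided that δ is small, qδ is large and δ^(2m) (qδ)^ρ ≥ 1. This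
amounts to finding O(q^d δ^m) shifted lattice points (a + θ)/q at which q f is O(δ)-close to η
modulo integers. On a cube of side N/q with N about √(qδ), f is affine up to O(δ/q). Fejér kernels
of length H about 1/δ then bound the points in the cube by a sum over integer frequencies h
(`card_cube_le`, `card_close_le`), involving only products of Fejér kernels at the entries of h ·
f'(α). This bound is averaged over the position α of the cube (`mul_card_le_of_cubes`). The
frequency h = 0 gives the expected main term, of relative size δ^m. For h ≠ 0, the rank condition
lets ρ of the functions h · ∂ᵢf serve as local coordinates, up to the scale ‖h‖, so averaging saves
a factor N^ρ (`exists_ball_lintegral_fejer_le`). The condition on δ makes N^(-ρ) at most of order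
δ^m.

Finally, ψ may be enlarged to max(ψ(q), q^(-κ)) with κ = ρ/(2m + ρ). This meets the condition on δ,
and its n-th powers stay summable exactly because κn > 1 (`exists_majorant`). Borel–Cantelli makes
the limsup set locally null, and the Lipschitz graph map carries null sets to null sets. -/

namespace KhinchinType

/-! ### Exponential sums and Fejér kernels. -/

/-- The character `e(x) = exp(2πix)`. -/
noncomputable def expChar (x : ℝ) : ℂ := Complex.exp ((2 * Real.pi * x : ℝ) * Complex.I)

lemma expChar_add (x y : ℝ) : expChar (x + y) = expChar x * expChar y := by
  rw [expChar, expChar, expChar, ← Complex.exp_add]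
  congr 1
  push_cast
  ring

@[simp] lemma norm_expChar (x : ℝ) : ‖expChar x‖ = 1 := by
  rw [expChar, Complex.norm_exp_ofReal_mul_I]

@[simp] lemma expChar_zero : expChar 0 = 1 := by simp [expChar]

lemma expChar_int (b : ℤ) : expChar b = 1 := by
  rw [expChar, Complex.exp_eq_one_iff]
  exact ⟨b, by push_cast; ring⟩

lemma expChar_sum {ι : Type*} (s : Finset ι) (x : ι → ℝ) :
    expChar (∑ i ∈ s, x i) = ∏ i ∈ s, expChar (x i) := by
  classical
  induction s using Finset.induction_on with
  | empty => simp
  | insert i s hi ih => rw [Finset.sum_insert hi, Finset.prod_insert hi, expChar_add, ih]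

lemma conj_expChar (x : ℝ) : (starRingEnd ℂ) (expChar x) = expChar (-x) := by
  rw [expChar, expChar, ← Complex.exp_conj, map_mul, Complex.conj_ofReal, Complex.conj_I]
  congr 1
  push_cast
  ring

lemma continuous_expChar : Continuous expChar := by
  unfold expChar
  fun_prop

/-- The Dirichlet sum `∑_{k < M} e(kx)`. -/
noncomputable def dirichletSum (M : ℕ) (x : ℝ) : ℂ := ∑ k : Fin M, expChar ((k : ℕ) * x)

lemma continuous_dirichletSum (M : ℕ) : Continuous (dirichletSum M) := by
  unfold dirichletSum
  have := continuous_expChar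
  fun_prop

lemma norm_dirichletSum_le (M : ℕ) (x : ℝ) : ‖dirichletSum M x‖ ≤ M := by
  refine (norm_sum_le _ _).trans ?_
  simp

lemma normSq_dirichletSum (M : ℕ) (x : ℝ) :
    ((‖dirichletSum M x‖ ^ 2 : ℝ) : ℂ) =
      ∑ σ : Fin M × Fin M, expChar ((((σ.1 : ℕ) : ℝ) - ((σ.2 : ℕ) : ℝ)) * x) := by
  have h : ((‖dirichletSum M x‖ ^ 2 : ℝ) : ℂ) =
      dirichletSum M x * (starRingEnd ℂ) (dirichletSum M x) := by
    rw [Complex.mul_conj, Complex.normSq_eq_norm_sq]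
  rw [h, dirichletSum, map_sum, Finset.sum_mul_sum, Fintype.sum_prod_type]
  refine Finset.sum_congr rfl fun i _ => Finset.sum_congr rfl fun j _ => ?_
  rw [conj_expChar, ← expChar_add]
  congr 1
  ring

lemma dirichletSum_add_int (M : ℕ) (x : ℝ) (b : ℤ) :
    dirichletSum M (x + b) = dirichletSum M x := by
  refine Finset.sum_congr rfl fun k _ => ?_
  have := expChar_int ((k : ℕ) * b)
  push_cast at this
  rw [mul_add, expChar_add, this, mul_one]

/-- After translation by b, every summand has argument at most π/3 in absolute value, hence real
part at least 1/2. This makes the Fejér kernel a majorant for closeness to an integer. -/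
lemma sq_le_normSq_dirichletSum {H : ℕ} (hH : 0 < H) {x : ℝ} {b : ℤ}
    (hx : |x - b| ≤ 1 / (6 * H)) : (H : ℝ) ^ 2 ≤ 4 * ‖dirichletSum H x‖ ^ 2 := by
  have hH' : (0 : ℝ) < H := by exact_mod_cast hH
  have key : (H : ℝ) / 2 ≤ ‖dirichletSum H x‖ := by
    have h1 : dirichletSum H x = dirichletSum H (x - b) := by
      rw [← dirichletSum_add_int H (x - b) b, sub_add_cancel]
    rw [h1]
    refine le_trans ?_ (Complex.re_le_norm _)
    rw [dirichletSum, Complex.re_sum]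
    have h2 : ∀ k : Fin H, (1 / 2 : ℝ) ≤ (expChar ((k : ℕ) * (x - b))).re := by
      intro k
      rw [expChar, Complex.exp_ofReal_mul_I_re, ← Real.cos_abs, ← Real.cos_pi_div_three]
      refine Real.cos_le_cos_of_nonneg_of_le_pi (abs_nonneg _) ?_ ?_
      · linarith [Real.pi_pos]
      · rw [abs_mul, abs_of_pos (by positivity : 0 < 2 * Real.pi), abs_mul, Nat.abs_cast]
        have hk : ((k : ℕ) : ℝ) ≤ H := by exact_mod_cast k.2.le
        calc 2 * Real.pi * ((k : ℕ) * |x - b|) ≤ 2 * Real.pi * (H * (1 / (6 * H))) := by gcongr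
          _ = Real.pi / 3 := by field_simp; ring
    calc (H : ℝ) / 2 = ∑ _k : Fin H, (1 / 2 : ℝ) := by simp; ring
      _ ≤ _ := Finset.sum_le_sum fun k _ => h2 k
  nlinarith [norm_nonneg (dirichletSum H x)]

lemma integral_expChar_int_mul (k : ℤ) :
    ∫ x in (0 : ℝ)..1, expChar (k * x) = if k = 0 then 1 else 0 := by
  split_ifs with hk
  · simp [hk]
  · have hc : (2 * Real.pi * k * Complex.I : ℂ) ≠ 0 := by
      simp [hk, Real.pi_ne_zero]
    have h : ∀ x : ℝ, expChar (k * x) = Complex.exp ((2 * Real.pi * k * Complex.I : ℂ) * x) := by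
      intro x
      rw [expChar]
      congr 1
      push_cast
      ring
    simp_rw [h]
    rw [integral_exp_mul_complex hc]
    have := expChar_int k
    rw [expChar] at this
    push_cast at this
    simp only [Complex.ofReal_one, mul_one, Complex.ofReal_zero, mul_zero, Complex.exp_zero]
    rw [this]
    simp

lemma integral_normSq_dirichletSum (M : ℕ) :
    ∫ x in (0 : ℝ)..1, ‖dirichletSum M x‖ ^ 2 = M := by
  have h : ((∫ x in (0 : ℝ)..1, ‖dirichletSum M x‖ ^ 2 : ℝ) : ℂ) = M := by
    rw [← intervalIntegral.integral_ofReal]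
    simp_rw [normSq_dirichletSum]
    have hint : ∀ σ : Fin M × Fin M,
        ∫ x in (0 : ℝ)..1, expChar ((((σ.1 : ℕ) : ℝ) - ((σ.2 : ℕ) : ℝ)) * x) =
          if σ.1 = σ.2 then 1 else 0 := by
      intro σ
      have := integral_expChar_int_mul (((σ.1 : ℕ) : ℤ) - ((σ.2 : ℕ) : ℤ))
      push_cast at this
      rw [this]
      congr 1
      rw [sub_eq_zero, Nat.cast_inj, Fin.val_inj]
    rw [intervalIntegral.integral_finsetSum]
    · simp_rw [hint]
      rw [Fintype.sum_prod_type]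
      simp
    · intro σ _
      refine Continuous.intervalIntegrable ?_ _ _
      have := continuous_expChar
      fun_prop
  exact_mod_cast h

/-- After rescaling, the interval is covered by fewer than 2(lam R + 1) periods, each of integral M
by orthogonality. The point is uniformity in `lam`, which will be the size of the frequency. -/
lemma lintegral_normSq_dirichletSum_le (M : ℕ) {lam R : ℝ} (hlam : 1 ≤ lam) (hR : 0 ≤ R) :
    ∫⁻ y in Set.Icc (-R) R, ENNReal.ofReal (‖dirichletSum M (lam * y)‖ ^ 2) ≤
      ENNReal.ofReal ((2 * R + 2) * M) := by
  have hcont : Continuous fun x => ‖dirichletSum M x‖ ^ 2 :=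
    (continuous_dirichletSum M).norm.pow 2
  have hlam0 : 0 < lam := by linarith
  have hcont' : Continuous fun x => ‖dirichletSum M (lam * x)‖ ^ 2 :=
    hcont.comp (continuous_const.mul continuous_id)
  rw [← ofReal_integral_eq_lintegral_ofReal (hcont'.continuousOn.integrableOn_Icc)
    (ae_of_all _ fun _ => by positivity)]
  refine ENNReal.ofReal_le_ofReal ?_
  rw [integral_Icc_eq_integral_Ioc, ← intervalIntegral.integral_of_le (by linarith),
    intervalIntegral.integral_comp_mul_left (fun x => ‖dirichletSum M x‖ ^ 2) hlam0.ne']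
  set n : ℕ := ⌈lam * R⌉₊ with hn
  have hn1 : lam * R ≤ n := Nat.le_ceil _
  have hn2 : (n : ℝ) < lam * R + 1 := Nat.ceil_lt_add_one (by positivity)
  have hper : Function.Periodic (fun x => ‖dirichletSum M x‖ ^ 2) 1 := by
    intro x
    have := dirichletSum_add_int M x 1
    push_cast at this
    simp only [this]
  have h1 : ∫ x in (lam * -R)..(lam * R), ‖dirichletSum M x‖ ^ 2 ≤
      ∫ x in (-(n : ℝ))..n, ‖dirichletSum M x‖ ^ 2 := by
    refine intervalIntegral.integral_mono_interval (by linarith) (by nlinarith) hn1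
      (ae_of_all _ fun _ => by positivity) (hcont.intervalIntegrable _ _)
  have h2 : ∫ x in (-(n : ℝ))..n, ‖dirichletSum M x‖ ^ 2 = (2 * n) * M := by
    have := hper.intervalIntegral_add_zsmul_eq (2 * n : ℕ) (-(n : ℝ))
      fun _ _ => hcont.intervalIntegrable _ _
    rw [hper.intervalIntegral_add_eq (-(n : ℝ)) 0, zero_add, integral_normSq_dirichletSum] at this
    convert this using 2
    · simp; ring
    · simp
  rw [h2] at h1
  have hM : (0 : ℝ) ≤ M := by positivity
  calc lam⁻¹ • ∫ x in (lam * -R)..(lam * R), ‖dirichletSum M x‖ ^ 2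
      ≤ lam⁻¹ * ((2 * n) * M) := by rw [smul_eq_mul]; gcongr
    _ ≤ lam⁻¹ * ((2 * (lam * R + 1)) * M) := by gcongr
    _ = (2 * R + 2 * lam⁻¹) * M := by field_simp
    _ ≤ (2 * R + 2) * M := by
        have : lam⁻¹ ≤ 1 := inv_le_one_of_one_le₀ hlam
        nlinarith

/-! ### Counting near-integer values of an affine map. -/

/-- The difference of the two indices of a pair, as a real number. -/
def finDiff {M : ℕ} (σ : Fin M × Fin M) : ℝ := ((σ.1 : ℕ) : ℝ) - ((σ.2 : ℕ) : ℝ)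

/-- Opening the squares gives a double sum of characters of a bilinear form in the differences of s
and k. Summing over s first produces the kernels on the right, weighted by phases that carry all
dependence on `c` and have modulus 1. -/
lemma sum_prod_normSq_dirichletSum_le {d m : ℕ} (H M : ℕ) (c : Fin m → ℝ)
    (A : Fin m → Fin d → ℝ) :
    ∑ s : Fin d → Fin M × Fin M,
        ∏ j, ‖dirichletSum H (c j + ∑ i, A j i * finDiff (s i))‖ ^ 2 ≤
      ∑ k : Fin m → Fin H × Fin H,
        ∏ i, ‖dirichletSum M (∑ j, finDiff (k j) * A j i)‖ ^ 2 := by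
  have key : ((∑ s : Fin d → Fin M × Fin M,
        ∏ j, ‖dirichletSum H (c j + ∑ i, A j i * finDiff (s i))‖ ^ 2 : ℝ) : ℂ) =
      ∑ k : Fin m → Fin H × Fin H, expChar (∑ j, finDiff (k j) * c j) *
        ((∏ i, ‖dirichletSum M (∑ j, finDiff (k j) * A j i)‖ ^ 2 : ℝ) : ℂ) := by
    rw [Complex.ofReal_sum]
    simp_rw [Complex.ofReal_prod, normSq_dirichletSum]
    simp_rw [Fintype.prod_sum]
    rw [Finset.sum_comm]
    refine Finset.sum_congr rfl fun k _ => ?_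
    rw [Finset.mul_sum]
    refine Finset.sum_congr rfl fun s _ => ?_
    rw [← expChar_sum, ← expChar_sum, ← expChar_add]
    congr 1
    simp_rw [mul_add, Finset.mul_sum, Finset.sum_add_distrib]
    rw [Finset.sum_comm (s := (Finset.univ : Finset (Fin d)))]
    congr 1
    refine Finset.sum_congr rfl fun j _ => Finset.sum_congr rfl fun i _ => ?_
    simp only [finDiff]
    ring
  have hnn : 0 ≤ ∑ s : Fin d → Fin M × Fin M,
      ∏ j, ‖dirichletSum H (c j + ∑ i, A j i * finDiff (s i))‖ ^ 2 :=
    Finset.sum_nonneg fun s _ => Finset.prod_nonneg fun j _ => by positivity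
  have h2 := congrArg norm key
  rw [Complex.norm_of_nonneg hnn] at h2
  rw [h2]
  refine (norm_sum_le _ _).trans (Finset.sum_le_sum fun k _ => ?_)
  rw [norm_mul, norm_expChar, one_mul, Complex.norm_of_nonneg]
  exact Finset.prod_nonneg fun j _ => by positivity

/-- The number of integer points `r` of the box `|r i| ≤ N` for which `c + A r` is close to an
integer vector is controlled by Fejér kernels at the entries of integer combinations of the rows
of `A`. -/
lemma card_close_le {d m : ℕ} {H : ℕ} (N : ℕ) (hH : 0 < H) (c : Fin m → ℝ)
    (A : Fin m → Fin d → ℝ) (T : Finset (Fin d → ℤ)) (hT : ∀ r ∈ T, ∀ i, |r i| ≤ N)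
    (hT' : ∀ r ∈ T, ∀ j, ∃ b : ℤ, |c j + ∑ i, A j i * r i - b| ≤ 1 / (6 * H)) :
    (N : ℝ) ^ d * T.card ≤ (4 / (H : ℝ) ^ 2) ^ m *
      ∑ k : Fin m → Fin H × Fin H,
        ∏ i, ‖dirichletSum (2 * N) (∑ j, finDiff (k j) * A j i)‖ ^ 2 := by
  classical
  have hH' : (0 : ℝ) < H := by exact_mod_cast hH
  refine le_trans ?_ (mul_le_mul_of_nonneg_left
    (sum_prod_normSq_dirichletSum_le H (2 * N) c A) (by positivity))
  rw [Finset.mul_sum]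
  set G : Finset (Fin d → Fin (2 * N) × Fin (2 * N)) :=
    Finset.univ.filter fun s => ∃ r ∈ T, ∀ i, finDiff (s i) = r i with hG
  have hone : ∀ s ∈ G, (1 : ℝ) ≤ (4 / (H : ℝ) ^ 2) ^ m *
      ∏ j, ‖dirichletSum H (c j + ∑ i, A j i * finDiff (s i))‖ ^ 2 := by
    intro s hs
    obtain ⟨r, hr, hrs⟩ := (Finset.mem_filter.mp hs).2
    have hpow : (4 / (H : ℝ) ^ 2) ^ m = ∏ _j : Fin m, (4 / (H : ℝ) ^ 2) := by
      rw [Finset.prod_const, Finset.card_univ, Fintype.card_fin]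
    rw [hpow, ← Finset.prod_mul_distrib]
    rw [← Finset.prod_const_one (s := (Finset.univ : Finset (Fin m)))]
    refine Finset.prod_le_prod (fun _ _ => zero_le_one) fun j _ => ?_
    obtain ⟨b, hb⟩ := hT' r hr j
    simp_rw [hrs]
    have := sq_le_normSq_dirichletSum hH hb
    rw [div_mul_eq_mul_div, le_div_iff₀ (by positivity)]
    linarith
  have hcard : (N : ℝ) ^ d * T.card ≤ G.card := by
    -- Each coordinate of r is a difference (u + r⁺) - (u + r⁻) in N ways, one for each 0 ≤ u < N.
    -- Both terms stay below 2N, whence the length 2N of the dual kernel.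
    have hinj : (T ×ˢ (Finset.univ : Finset (Fin d → Fin N))).card ≤ G.card := by
      refine Finset.card_le_card_of_injOn (fun x i =>
        if h : |x.1 i| ≤ N then
          (⟨(x.2 i : ℕ) + (x.1 i).toNat, by have := (x.2 i).2; have := abs_le.mp h; omega⟩,
           ⟨(x.2 i : ℕ) + (-x.1 i).toNat, by have := (x.2 i).2; have := abs_le.mp h; omega⟩)
        else (⟨x.2 i, by have := (x.2 i).2; omega⟩, ⟨x.2 i, by have := (x.2 i).2; omega⟩)) ?_ ?_
      · rintro ⟨r, u⟩ hx
        simp only [Finset.coe_product, Set.mem_prod, Finset.mem_coe] at hx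
        simp only [hG, Finset.coe_filter, Finset.mem_univ, true_and, Set.mem_ofPred_eq]
        refine ⟨r, hx.1, fun i => ?_⟩
        rw [dif_pos (hT r hx.1 i)]
        simp only [finDiff]
        have h1 : ((((u i : ℕ) + (r i).toNat : ℕ) : ℤ) - (((u i : ℕ) + (-r i).toNat : ℕ) : ℤ)) =
            r i := by omega
        exact_mod_cast h1
      · rintro ⟨r, u⟩ hx ⟨r', u'⟩ hx' heq
        simp only [Finset.coe_product, Set.mem_prod, Finset.mem_coe] at hx hx'
        have hi : ∀ i, r i = r' i ∧ (u i : ℕ) = u' i := by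
          intro i
          have h := congrFun heq i
          simp only [dif_pos (hT r hx.1 i), dif_pos (hT r' hx'.1 i), Prod.mk.injEq,
            Fin.mk.injEq] at h
          omega
        refine Prod.ext (funext fun i => (hi i).1) (funext fun i => Fin.ext (hi i).2)
    rw [Finset.card_product] at hinj
    simp only [Finset.card_univ, Fintype.card_fun, Fintype.card_fin] at hinj
    rw [mul_comm]
    exact_mod_cast hinj
  calc (N : ℝ) ^ d * T.card ≤ G.card := hcard
    _ = ∑ s ∈ G, (1 : ℝ) := by simp
    _ ≤ ∑ s ∈ G, _ := Finset.sum_le_sum hone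
    _ ≤ _ := Finset.sum_le_sum_of_subset_of_nonneg (Finset.subset_univ _) fun s _ _ =>
        mul_nonneg (by positivity) (Finset.prod_nonneg fun j _ => by positivity)

lemma card_finDiff_eq_zero (m H : ℕ) :
    (Finset.univ.filter fun k : Fin m → Fin H × Fin H => ∀ j, (k j).1 = (k j).2).card = H ^ m := by
  have h : (Finset.univ.filter fun k : Fin m → Fin H × Fin H => ∀ j, (k j).1 = (k j).2) =
      Finset.univ.image fun (x : Fin m → Fin H) j => (x j, x j) := by
    ext k
    simp only [Finset.mem_filter, Finset.mem_univ, true_and, Finset.mem_image]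
    refine ⟨fun hk => ⟨fun j => (k j).1, funext fun j => Prod.ext rfl (hk j)⟩, ?_⟩
    rintro ⟨x, rfl⟩ j
    rfl
  rw [h, Finset.card_image_of_injective _ fun x y hxy => funext fun j =>
    congrArg Prod.fst (congrFun hxy j)]
  simp

/-! ### Mean values of Fejér kernels under a rank condition. -/

/-- A maximal independent set of rows is completed to a basis, and the new vectors occupy the
remaining rows. The result will be the derivative of a local coordinate system. -/
lemma exists_rows_extend_isUnit {d ρ : ℕ} (S : Matrix (Fin d) (Fin d) ℝ) (h : ρ ≤ S.rank) :
    ∃ I : Finset (Fin d), ρ ≤ I.card ∧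
      ∃ L : Matrix (Fin d) (Fin d) ℝ, (∀ i ∈ I, L i = S i) ∧ IsUnit L := by
  classical
  obtain ⟨κ, a, ha, hspan, hli⟩ := exists_linearIndependent' ℝ S.row
  have : Finite κ := Finite.of_injective a ha
  have : Fintype κ := Fintype.ofFinite κ
  have hcard : S.rank = Fintype.card κ := by
    rw [Matrix.rank_eq_finrank_span_row, ← hspan, finrank_span_eq_card hli]
  let e := Equiv.ofInjective a ha
  let B := Module.Basis.sumExtend hli
  have hX : Finite (κ ⊕ Module.Basis.sumExtendIndex hli) := Module.Finite.finite_basis B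
  have : Finite (Module.Basis.sumExtendIndex hli) := Finite.of_injective _
    (Sum.inr_injective (α := κ))
  have : Fintype (Module.Basis.sumExtendIndex hli) := Fintype.ofFinite _
  have hd : Fintype.card κ + Fintype.card (Module.Basis.sumExtendIndex hli) = d := by
    rw [← Fintype.card_sum, ← Module.finrank_eq_card_basis B, Module.finrank_fin_fun]
  have hr : Fintype.card (Set.range a) = Fintype.card κ := (Fintype.card_congr e).symm
  have hc : Fintype.card ((Set.range a)ᶜ : Set (Fin d)) =
      Fintype.card (Module.Basis.sumExtendIndex hli) := by
    rw [Fintype.card_compl_set, hr, Fintype.card_fin]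
    omega
  let e' := Fintype.equivOfCardEq hc
  let σ : Fin d ≃ κ ⊕ Module.Basis.sumExtendIndex hli :=
    (Equiv.Set.sumCompl (Set.range a)).symm.trans (Equiv.sumCongr e.symm e')
  refine ⟨Finset.univ.image a, ?_, Matrix.of fun i => B (σ i), ?_, ?_⟩
  · rw [Finset.card_image_of_injective _ ha, Finset.card_univ, ← hcard]
    exact h
  · intro i hi
    obtain ⟨k, -, rfl⟩ := Finset.mem_image.mp hi
    have h1 : σ (a k) = Sum.inl k := by
      simp only [σ, Equiv.trans_apply]
      rw [Equiv.Set.sumCompl_symm_apply_of_mem (Set.mem_range_self k)]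
      simp only [Equiv.sumCongr_apply, Sum.map_inl, Sum.inl.injEq]
      rw [Equiv.symm_apply_eq]
      rfl
    change B (σ (a k)) = S (a k)
    rw [h1]
    simp only [B, Module.Basis.sumExtend]
    rw [Module.Basis.reindex_apply, Module.Basis.extend_apply_self]
    rfl
  · rw [← Matrix.linearIndependent_rows_iff_isUnit]
    exact B.linearIndependent.comp _ σ.injective

/-- A change of variables without Jacobian: the inverse of Φ is K-Lipschitz, so it enlarges
d-dimensional Hausdorff measure, here Lebesgue measure, by at most K^d. -/
lemma lintegral_comp_le_of_antilipschitzOn {d : ℕ} {B : Set (Fin d → ℝ)}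
    {Φ : (Fin d → ℝ) → (Fin d → ℝ)} {K : ℝ≥0} (hB : MeasurableSet B)
    (hΦ : ∀ x ∈ B, ∀ y ∈ B, dist x y ≤ K * dist (Φ x) (Φ y)) (hc : ContinuousOn Φ B)
    {G : (Fin d → ℝ) → ENNReal} (hG : Measurable G) :
    ∫⁻ x in B, G (Φ x) ≤ (K : ENNReal) ^ d * ∫⁻ y, G y := by
  have hΦm : AEMeasurable Φ (volume.restrict B) := hc.aemeasurable hB
  rw [← lintegral_map' hG.aemeasurable hΦm, ← lintegral_const_mul _ hG,
    lintegral_const_mul _ hG, ← smul_eq_mul, ← lintegral_smul_measure]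
  refine lintegral_mono' (Measure.le_iff.2 fun S hS => ?_) le_rfl
  rw [Measure.map_apply_of_aemeasurable hΦm hS, Measure.smul_apply, smul_eq_mul,
    Measure.restrict_apply' hB]
  have hinj : Set.InjOn Φ B := by
    intro x hx y hy hxy
    have := hΦ x hx y hy
    rw [hxy, dist_self, mul_zero] at this
    exact dist_le_zero.mp this
  set T := Φ ⁻¹' S ∩ B with hT
  have hlip : LipschitzOnWith K (Function.invFunOn Φ B) (Φ '' T) := by
    refine LipschitzOnWith.of_dist_le_mul ?_
    rintro _ ⟨x, hx, rfl⟩ _ ⟨y, hy, rfl⟩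
    rw [hinj.leftInvOn_invFunOn hx.2, hinj.leftInvOn_invFunOn hy.2]
    exact hΦ x hx.2 y hy.2
  have himg : Function.invFunOn Φ B '' (Φ '' T) = T := by
    rw [Set.image_image]
    refine (Set.image_congr fun x hx => hinj.leftInvOn_invFunOn hx.2).trans ?_
    simp
  have h1 := hlip.hausdorffMeasure_image_le (d := (d : ℝ)) (Nat.cast_nonneg d)
  have h2 : (Measure.hausdorffMeasure (d : ℝ) : Measure (Fin d → ℝ)) = volume := by
    have := hausdorffMeasure_pi_real (ι := Fin d)
    rwa [Fintype.card_fin] at this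
  rw [himg, h2, ENNReal.rpow_natCast] at h1
  refine h1.trans ?_
  gcongr
  rintro _ ⟨x, hx, rfl⟩
  exact hx.1

lemma lintegral_ofReal_prod {d : ℕ} {w : Fin d → ℝ → ℝ} (hw : ∀ i, Integrable (w i))
    (h0 : ∀ i x, 0 ≤ w i x) :
    ∫⁻ y : Fin d → ℝ, ENNReal.ofReal (∏ i, w i (y i)) = ∏ i, ∫⁻ x, ENNReal.ofReal (w i x) := by
  have hint : Integrable (fun y : Fin d → ℝ => ∏ i, w i (y i)) volume :=
    Integrable.fintype_prod hw
  rw [← ofReal_integral_eq_lintegral_ofReal hint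
    (ae_of_all _ fun y => Finset.prod_nonneg fun i _ => h0 i _),
    integral_fintype_prod_volume_eq_prod, ENNReal.ofReal_prod_of_nonneg
      fun i _ => integral_nonneg (h0 i)]
  exact Finset.prod_congr rfl fun i _ =>
    ofReal_integral_eq_lintegral_ofReal (hw i) (ae_of_all _ (h0 i))

/-- Strict differentiability jointly in (t, α) gives one radius and one constant for all t near
`t0`, as the later compactness argument needs. -/
lemma exists_nhds_antilipschitz {d m : ℕ} {α0 : Fin d → ℝ}
    {F : Fin m → Fin d → (Fin d → ℝ) → ℝ} {G : Fin m → Fin d → (Fin d → ℝ) →L[ℝ] ℝ}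
    (hF : ∀ j i, HasStrictFDerivAt (F j i) (G j i) α0) (t0 : Fin m → ℝ) (I : Finset (Fin d))
    {L : Matrix (Fin d) (Fin d) ℝ} (hL : IsUnit L)
    (hI : ∀ i ∈ I, ∀ k, L i k = ∑ j, t0 j * G j i (Pi.single k 1)) :
    ∃ Ψ : (Fin m → ℝ) → (Fin d → ℝ) → (Fin d → ℝ),
      (∀ t α, ∀ i ∈ I, Ψ t α i = ∑ j, t j * F j i α) ∧
      ∃ r > 0, ∃ K : ℝ≥0, ∃ R : ℝ, 0 ≤ R ∧ ∀ t ∈ Metric.ball t0 r,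
        ContinuousOn (Ψ t) (Metric.ball α0 r) ∧
        (∀ x ∈ Metric.ball α0 r, ∀ i, |Ψ t x i| ≤ R) ∧
        ∀ x ∈ Metric.ball α0 r, ∀ y ∈ Metric.ball α0 r,
          dist x y ≤ K * dist (Ψ t x) (Ψ t y) := by
  classical
  -- Coordinates outside `I` are filled in by linear functions, so that the α-derivative at (t0, α0)
  -- is exactly `L`.
  let Ψ : (Fin m → ℝ) × (Fin d → ℝ) → (Fin d → ℝ) := fun p i =>
    if i ∈ I then ∑ j, p.1 j * F j i p.2 else (L.mulVec p.2) i
  have hstrict : ∃ Ψ' : ((Fin m → ℝ) × (Fin d → ℝ)) →L[ℝ] (Fin d → ℝ),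
      HasStrictFDerivAt Ψ Ψ' (t0, α0) ∧ ∀ v, Ψ' (0, v) = L.mulVec v := by
    have hcomp : ∀ i, ∃ D : ((Fin m → ℝ) × (Fin d → ℝ)) →L[ℝ] ℝ,
        HasStrictFDerivAt (fun p => Ψ p i) D (t0, α0) ∧ ∀ v, D (0, v) = L.mulVec v i := by
      intro i
      by_cases hi : i ∈ I
      · have h1 : ∀ j, HasStrictFDerivAt (fun p : (Fin m → ℝ) × (Fin d → ℝ) => p.1 j * F j i p.2)
            (t0 j • (G j i).comp (ContinuousLinearMap.snd ℝ (Fin m → ℝ) (Fin d → ℝ)) +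
              F j i α0 • (ContinuousLinearMap.proj j).comp
                (ContinuousLinearMap.fst ℝ (Fin m → ℝ) (Fin d → ℝ))) (t0, α0) := by
          intro j
          have ha : HasStrictFDerivAt (fun p : (Fin m → ℝ) × (Fin d → ℝ) => p.1 j)
              ((ContinuousLinearMap.proj j).comp
                (ContinuousLinearMap.fst ℝ (Fin m → ℝ) (Fin d → ℝ))) (t0, α0) :=
            ((ContinuousLinearMap.proj (R := ℝ) (φ := fun _ : Fin m => ℝ) j).comp
              (ContinuousLinearMap.fst ℝ (Fin m → ℝ) (Fin d → ℝ))).hasStrictFDerivAt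
          have hb : HasStrictFDerivAt (fun p : (Fin m → ℝ) × (Fin d → ℝ) => F j i p.2)
              ((G j i).comp (ContinuousLinearMap.snd ℝ (Fin m → ℝ) (Fin d → ℝ))) (t0, α0) :=
            HasStrictFDerivAt.comp (t0, α0) (hF j i) hasStrictFDerivAt_snd
          exact ha.mul hb
        have h2 : (fun p => Ψ p i) = fun p => ∑ j, p.1 j * F j i p.2 := funext fun p => if_pos hi
        rw [h2]
        refine ⟨_, HasStrictFDerivAt.fun_sum fun j _ => h1 j, fun v => ?_⟩
        · have hv : ∀ j, G j i v = ∑ k, v k * G j i (Pi.single k 1) := by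
            intro j
            conv_lhs => rw [pi_eq_sum_univ' v]
            simp [map_sum]
          simp only [sum_apply, add_apply, smul_apply, ContinuousLinearMap.comp_apply,
            ContinuousLinearMap.coe_snd', ContinuousLinearMap.coe_fst', map_zero,
            Matrix.mulVec, dotProduct, smul_eq_mul, hI i hi, hv]
          simp_rw [Finset.mul_sum, Finset.sum_mul, mul_zero, add_zero]
          rw [Finset.sum_comm]
          refine Finset.sum_congr rfl fun k _ => Finset.sum_congr rfl fun j _ => by ring
      · refine ⟨((ContinuousLinearMap.proj i).comp L.mulVecLin.toContinuousLinearMap).comp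
          (ContinuousLinearMap.snd ℝ (Fin m → ℝ) (Fin d → ℝ)), ?_, fun v => rfl⟩
        simp only [Ψ, if_neg hi]
        exact (((ContinuousLinearMap.proj i).comp L.mulVecLin.toContinuousLinearMap).comp
          (ContinuousLinearMap.snd ℝ (Fin m → ℝ) (Fin d → ℝ))).hasStrictFDerivAt
    choose D hD hD' using hcomp
    exact ⟨ContinuousLinearMap.pi D, hasStrictFDerivAt_pi'.2 hD, fun v => funext fun i => hD' i v⟩
  obtain ⟨Ψ', hΨ, hΨ'⟩ := hstrict
  obtain ⟨K, hK, hLK⟩ := LinearMap.exists_antilipschitzWith L.mulVecLin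
    (LinearMap.ker_eq_bot.mpr (Matrix.mulVec_injective_iff_isUnit.mpr hL))
  -- Half of the expansion constant of `L`: the nonlinear error is absorbed and the final constant
  -- is 2K.
  obtain ⟨s, hs, happ⟩ := hΨ.approximates_deriv_on_nhds (c := K⁻¹ / 2) (Or.inr (by positivity))
  obtain ⟨K', s', hs', hlip⟩ := hΨ.exists_lipschitzOnWith
  obtain ⟨r, hr, hball⟩ := Metric.mem_nhds_iff.mp (Filter.inter_mem hs hs')
  rw [← ball_prod_same] at hball
  refine ⟨fun t x => Ψ (t, x), fun t x i hi => if_pos hi, r, hr, 2 * K,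
    ‖Ψ (t0, α0)‖ + K' * r, by positivity, fun t ht => ⟨?_, ?_, ?_⟩⟩
  · refine hlip.continuousOn.comp (by fun_prop) fun x hx => (hball ⟨ht, hx⟩).2
  · intro x hx i
    have h1 := hlip.dist_le_mul (t, x) (hball ⟨ht, hx⟩).2 (t0, α0)
      (hball ⟨Metric.mem_ball_self hr, Metric.mem_ball_self hr⟩).2
    have h2 : dist (t, x) (t0, α0) ≤ r := by
      rw [Prod.dist_eq]
      exact max_le (Metric.mem_ball.mp ht).le (Metric.mem_ball.mp hx).le
    have h3 := norm_le_pi_norm (Ψ (t, x)) i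
    rw [Real.norm_eq_abs] at h3
    have h4 : ‖Ψ (t, x)‖ ≤ ‖Ψ (t0, α0)‖ + dist (Ψ (t, x)) (Ψ (t0, α0)) := by
      rw [dist_eq_norm]
      have := norm_add_le (Ψ (t0, α0)) (Ψ (t, x) - Ψ (t0, α0))
      rwa [add_sub_cancel] at this
    have h5 : (K' : ℝ) * dist (t, x) (t0, α0) ≤ K' * r := by gcongr
    linarith
  · intro x hx y hy
    have h1 := happ (t, x) (hball ⟨ht, hx⟩).1 (t, y) (hball ⟨ht, hy⟩).1
    rw [show ((t, x) - (t, y) : (Fin m → ℝ) × (Fin d → ℝ)) = (0, x - y) by simp, hΨ'] at h1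
    have h2 := hLK.le_mul_dist x y
    rw [Matrix.mulVecLin_apply, Matrix.mulVecLin_apply, dist_eq_norm (L.mulVec x),
      ← Matrix.mulVec_sub] at h2
    have h3 : ‖L.mulVec (x - y)‖ ≤ ‖Ψ (t, x) - Ψ (t, y)‖ +
        ‖Ψ (t, x) - Ψ (t, y) - L.mulVec (x - y)‖ := by
      have := norm_sub_le (Ψ (t, x) - Ψ (t, y)) (Ψ (t, x) - Ψ (t, y) - L.mulVec (x - y))
      rwa [sub_sub_cancel] at this
    have h4 : ‖((0 : Fin m → ℝ), x - y)‖ = dist x y := by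
      rw [dist_eq_norm, Prod.norm_mk, norm_zero, max_eq_right (norm_nonneg _)]
    rw [h4] at h1
    rw [dist_eq_norm (Ψ (t, x))]
    push_cast at h1 ⊢
    have hK' : (0 : ℝ) < K := hK
    have h5 : dist x y ≤ K * (‖Ψ (t, x) - Ψ (t, y)‖ + (K : ℝ)⁻¹ / 2 * dist x y) := by
      refine h2.trans ?_
      gcongr
      linarith
    have h6 : (K : ℝ) * ((K : ℝ)⁻¹ / 2 * dist x y) = dist x y / 2 := by field_simp
    rw [mul_add, h6] at h5
    linarith

/-- In the coordinates Ψ, the at least ρ kernels indexed by `I` integrate to O(M) each. The others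
are bounded trivially by M². The total is O(M^(2d-ρ)). -/
lemma exists_nhds_lintegral_fejer_le {d m ρ : ℕ} {α0 : Fin d → ℝ}
    {F : Fin m → Fin d → (Fin d → ℝ) → ℝ} {G : Fin m → Fin d → (Fin d → ℝ) →L[ℝ] ℝ}
    (hF : ∀ j i, HasStrictFDerivAt (F j i) (G j i) α0) (t0 : Fin m → ℝ)
    (hrank : ρ ≤ (Matrix.of fun i k => ∑ j, t0 j * G j i (Pi.single k 1)).rank) :
    ∃ r > 0, ∃ C : ℝ≥0, ∀ t ∈ Metric.ball t0 r, ∀ lam : ℝ, 1 ≤ lam → ∀ M : ℕ, 0 < M →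
      (M : ENNReal) ^ ρ * ∫⁻ α in Metric.ball α0 r,
        ENNReal.ofReal (∏ i, ‖dirichletSum M (lam * ∑ j, t j * F j i α)‖ ^ 2) ≤
      C * (M : ENNReal) ^ (2 * d) := by
  classical
  obtain ⟨I, hI, L, hLI, hL⟩ := exists_rows_extend_isUnit _ hrank
  obtain ⟨Ψ, hΨ, r, hr, K, R, hR, hball⟩ := exists_nhds_antilipschitz hF t0 I hL
    fun i hi k => by rw [hLI i hi]; rfl
  refine ⟨r, hr, K ^ d * (2 * R.toNNReal + 2) ^ d, fun t ht lam hlam M hM => ?_⟩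
  obtain ⟨hcont, hbdd, hanti⟩ := hball t ht
  let w0 : Fin d → ℝ → ℝ := fun i s =>
    if i ∈ I then ‖dirichletSum M (lam * s)‖ ^ 2 else (M : ℝ) ^ 2
  let w : Fin d → ℝ → ℝ := fun i => (Set.Icc (-R) R).indicator (w0 i)
  have hw0 : ∀ i, Continuous (w0 i) := by
    intro i
    simp only [w0]
    split_ifs
    · exact ((continuous_dirichletSum M).comp (by fun_prop)).norm.pow 2
    · fun_prop
  have hw0nn : ∀ i s, 0 ≤ w0 i s := by
    intro i s
    simp only [w0]
    split_ifs <;> positivity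
  have hwnn : ∀ i s, 0 ≤ w i s := fun i s => Set.indicator_nonneg (fun _ _ => hw0nn i _) s
  have hwm : ∀ i, Measurable (w i) := fun i => (hw0 i).measurable.indicator measurableSet_Icc
  have hwint : ∀ i, Integrable (w i) := fun i =>
    (integrable_indicator_iff measurableSet_Icc).mpr (hw0 i).continuousOn.integrableOn_Icc
  have hle : ∀ α ∈ Metric.ball α0 r,
      ENNReal.ofReal (∏ i, ‖dirichletSum M (lam * ∑ j, t j * F j i α)‖ ^ 2) ≤
        ENNReal.ofReal (∏ i, w i (Ψ t α i)) := by
    intro α hα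
    refine ENNReal.ofReal_le_ofReal (Finset.prod_le_prod (fun _ _ => by positivity) fun i _ => ?_)
    have h1 : Ψ t α i ∈ Set.Icc (-R) R := abs_le.mp (hbdd α hα i)
    simp only [w, Set.indicator_of_mem h1, w0]
    split_ifs with hi
    · rw [hΨ t α i hi]
    · gcongr
      exact norm_dirichletSum_le _ _
  have hwi : ∀ i, ∫⁻ x, ENNReal.ofReal (w i x) ≤
      ENNReal.ofReal (2 * R + 2) * ENNReal.ofReal (if i ∈ I then M else (M : ℝ) ^ 2) := by
    intro i
    have h1 : ∫⁻ x, ENNReal.ofReal (w i x) =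
        ∫⁻ x in Set.Icc (-R) R, ENNReal.ofReal (w0 i x) := by
      rw [← lintegral_indicator measurableSet_Icc]
      refine lintegral_congr fun x => ?_
      simp only [w, Set.indicator]
      split_ifs <;> simp
    rw [h1, ← ENNReal.ofReal_mul (by positivity)]
    by_cases hi : i ∈ I
    · simp only [w0, if_pos hi]
      exact lintegral_normSq_dirichletSum_le M hlam hR
    · simp only [w0, if_neg hi, setLIntegral_const, Real.volume_Icc]
      rw [← ENNReal.ofReal_mul (by positivity)]
      refine ENNReal.ofReal_le_ofReal ?_
      nlinarith [sq_nonneg (M : ℝ)]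
  have hmeas : Measurable fun y : Fin d → ℝ => ENNReal.ofReal (∏ i, w i (y i)) :=
    (Finset.measurable_prod _ fun i _ => (hwm i).comp (measurable_pi_apply i)).ennreal_ofReal
  have hint := lintegral_comp_le_of_antilipschitzOn measurableSet_ball hanti hcont hmeas
  have hprod : (M : ENNReal) ^ ρ * ∏ i : Fin d, ENNReal.ofReal (if i ∈ I then M else (M : ℝ) ^ 2) ≤
      (M : ENNReal) ^ (2 * d) := by
    have h1 : (M : ENNReal) ^ I.card = ∏ i : Fin d, if i ∈ I then (M : ENNReal) else 1 := by
      rw [Finset.prod_ite_mem, Finset.univ_inter, Finset.prod_const]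
    have hM1 : (1 : ENNReal) ≤ M := by exact_mod_cast hM
    calc _ ≤ (M : ENNReal) ^ I.card *
          ∏ i : Fin d, ENNReal.ofReal (if i ∈ I then M else (M : ℝ) ^ 2) := by gcongr
      _ = ∏ _i : Fin d, (M : ENNReal) ^ 2 := by
          rw [h1, ← Finset.prod_mul_distrib]
          refine Finset.prod_congr rfl fun i _ => ?_
          split_ifs
          · rw [ENNReal.ofReal_natCast, sq]
          · rw [one_mul, ENNReal.ofReal_pow (by positivity), ENNReal.ofReal_natCast]
      _ = _ := by rw [Finset.prod_const, Finset.card_univ, Fintype.card_fin, ← pow_mul]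
  calc _ ≤ (M : ENNReal) ^ ρ * ((K : ENNReal) ^ d *
        ∏ i, (ENNReal.ofReal (2 * R + 2) *
          ENNReal.ofReal (if i ∈ I then M else (M : ℝ) ^ 2))) := by
        gcongr
        refine (setLIntegral_mono' measurableSet_ball hle).trans (hint.trans ?_)
        rw [lintegral_ofReal_prod hwint hwnn]
        gcongr with i
        exact hwi i
    _ = (K : ENNReal) ^ d * ENNReal.ofReal (2 * R + 2) ^ d * ((M : ENNReal) ^ ρ *
          ∏ i : Fin d, ENNReal.ofReal (if i ∈ I then M else (M : ℝ) ^ 2)) := by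
        rw [Finset.prod_mul_distrib, Finset.prod_const, Finset.card_univ, Fintype.card_fin]
        ring
    _ ≤ (K : ENNReal) ^ d * ENNReal.ofReal (2 * R + 2) ^ d * (M : ENNReal) ^ (2 * d) := by
        gcongr
    _ = _ := by
        congr 1
        push_cast
        congr 2
        rw [ENNReal.ofReal_add (by positivity) (by norm_num), ENNReal.ofReal_mul (by norm_num)]
        simp [ENNReal.ofReal]

/-- Write h as ‖h‖ times a unit vector t. Compactness of the unit sphere makes the local estimates
uniform in t, and ‖h‖ plays the role of `lam`. -/
lemma exists_ball_lintegral_fejer_le {d m ρ : ℕ} {α0 : Fin d → ℝ}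
    {F : Fin m → Fin d → (Fin d → ℝ) → ℝ} {G : Fin m → Fin d → (Fin d → ℝ) →L[ℝ] ℝ}
    (hF : ∀ j i, HasStrictFDerivAt (F j i) (G j i) α0)
    (hrank : ∀ t : Fin m → ℝ, t ≠ 0 →
      ρ ≤ (Matrix.of fun i k => ∑ j, t j * G j i (Pi.single k 1)).rank) :
    ∃ r > 0, ∃ C : ℝ≥0, ∀ h : Fin m → ℝ, 1 ≤ ‖h‖ → ∀ M : ℕ, 0 < M →
      (M : ENNReal) ^ ρ * ∫⁻ α in Metric.ball α0 r,
        ENNReal.ofReal (∏ i, ‖dirichletSum M (∑ j, h j * F j i α)‖ ^ 2) ≤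
      C * (M : ENNReal) ^ (2 * d) := by
  have key : ∃ r > 0, ∃ C : ℝ≥0, ∀ t ∈ Metric.sphere (0 : Fin m → ℝ) 1,
      ∀ lam : ℝ, 1 ≤ lam → ∀ M : ℕ, 0 < M →
      (M : ENNReal) ^ ρ * ∫⁻ α in Metric.ball α0 r,
        ENNReal.ofReal (∏ i, ‖dirichletSum M (lam * ∑ j, t j * F j i α)‖ ^ 2) ≤
      C * (M : ENNReal) ^ (2 * d) := by
    refine (isCompact_sphere (0 : Fin m → ℝ) 1).induction_on
      (p := fun T => ∃ r > 0, ∃ C : ℝ≥0, ∀ t ∈ T, ∀ lam : ℝ, 1 ≤ lam → ∀ M : ℕ, 0 < M →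
        (M : ENNReal) ^ ρ * ∫⁻ α in Metric.ball α0 r,
          ENNReal.ofReal (∏ i, ‖dirichletSum M (lam * ∑ j, t j * F j i α)‖ ^ 2) ≤
        C * (M : ENNReal) ^ (2 * d)) ?_ ?_ ?_ ?_
    · exact ⟨1, one_pos, 0, fun t ht => absurd ht (Set.notMem_empty t)⟩
    · rintro s t hst ⟨r, hr, C, h⟩
      exact ⟨r, hr, C, fun u hu => h u (hst hu)⟩
    · rintro s t ⟨r, hr, C, h⟩ ⟨r', hr', C', h'⟩
      refine ⟨min r r', lt_min hr hr', C + C', fun u hu lam hlam M hM => ?_⟩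
      rcases hu with hu | hu
      · calc _ ≤ _ := mul_le_mul_right (lintegral_mono_set
              (Metric.ball_subset_ball (min_le_left _ _))) _
          _ ≤ C * (M : ENNReal) ^ (2 * d) := h u hu lam hlam M hM
          _ ≤ _ := by
            gcongr
            exact le_self_add
      · calc _ ≤ _ := mul_le_mul_right (lintegral_mono_set
              (Metric.ball_subset_ball (min_le_right _ _))) _
          _ ≤ C' * (M : ENNReal) ^ (2 * d) := h' u hu lam hlam M hM
          _ ≤ _ := by
            gcongr
            exact le_add_self
    · intro t ht
      have ht0 : t ≠ 0 := by
        rintro rfl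
        simp at ht
      obtain ⟨r, hr, C, h⟩ := exists_nhds_lintegral_fejer_le hF t (hrank t ht0)
      exact ⟨_, mem_nhdsWithin_of_mem_nhds (Metric.ball_mem_nhds t hr), r, hr, C, h⟩
  obtain ⟨r, hr, C, hC⟩ := key
  refine ⟨r, hr, C, fun h hh M hM => ?_⟩
  have hh0 : ‖h‖ ≠ 0 := by linarith
  have h1 := hC (‖h‖⁻¹ • h) (by simp [norm_smul, hh0]) ‖h‖ hh M hM
  have h2 : ∀ i α, ‖h‖ * ∑ j, (‖h‖⁻¹ • h) j * F j i α = ∑ j, h j * F j i α := by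
    intro i α
    rw [Finset.mul_sum]
    refine Finset.sum_congr rfl fun j _ => ?_
    rw [Pi.smul_apply, smul_eq_mul]
    field_simp
  simpa only [h2] using h1

/-! ### Linearisation, counting in small cubes and averaging over them. -/

lemma exists_ball_linearization {d m : ℕ} {α0 : Fin d → ℝ} {g : (Fin d → ℝ) → Fin m → ℝ}
    {F : Fin m → Fin d → (Fin d → ℝ) → ℝ} {G : Fin m → Fin d → (Fin d → ℝ) →L[ℝ] ℝ}
    (hg : ∀ᶠ α in nhds α0, ∀ j, HasFDerivAt (fun β => g β j)
      (∑ i, F j i α • (ContinuousLinearMap.proj i : (Fin d → ℝ) →L[ℝ] ℝ)) α)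
    (hF : ∀ j i, HasStrictFDerivAt (F j i) (G j i) α0) :
    ∃ r > 0, ∃ L : ℝ, 1 ≤ L ∧ (∀ j i, ContinuousOn (F j i) (Metric.ball α0 r)) ∧
      ∀ α ∈ Metric.ball α0 r, ∀ β ∈ Metric.ball α0 r, ∀ j,
        |g β j - g α j| ≤ L * ‖β - α‖ ∧
        |g β j - g α j - ∑ i, F j i α * (β i - α i)| ≤ L * ‖β - α‖ ^ 2 := by
  have hlip : ∃ K : ℝ, 0 ≤ K ∧ ∃ s ∈ nhds α0, ∀ j i, ContinuousOn (F j i) s ∧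
      ∀ x ∈ s, ∀ y ∈ s, |F j i x - F j i y| ≤ K * ‖x - y‖ := by
    choose K s hs h using fun j i => (hF j i).exists_lipschitzOnWith
    refine ⟨∑ j, ∑ i, (K j i : ℝ), by positivity, ⋂ j, ⋂ i, s j i,
      Filter.iInter_mem.2 fun j => Filter.iInter_mem.2 fun i => hs j i, fun j i => ?_⟩
    have hsub : (⋂ j, ⋂ i, s j i) ⊆ s j i :=
      (Set.iInter_subset _ j).trans (Set.iInter_subset _ i)
    refine ⟨(h j i).continuousOn.mono hsub, fun x hx y hy => ?_⟩
    have h1 := (h j i).dist_le_mul x (hsub hx) y (hsub hy)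
    rw [Real.dist_eq, dist_eq_norm] at h1
    refine h1.trans ?_
    gcongr
    calc (K j i : ℝ) ≤ ∑ i, (K j i : ℝ) :=
          Finset.single_le_sum (f := fun i => (K j i : ℝ)) (fun _ _ => by positivity)
            (Finset.mem_univ i)
      _ ≤ _ := Finset.single_le_sum (f := fun j => ∑ i, (K j i : ℝ)) (fun _ _ => by positivity)
            (Finset.mem_univ j)
  obtain ⟨K, hK, s, hs, hlip⟩ := hlip
  obtain ⟨r', hr', hball'⟩ := Metric.mem_nhds_iff.mp (Filter.inter_mem hs hg)
  set r := min r' 1 with hr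
  have hr0 : 0 < r := lt_min hr' one_pos
  have hball : Metric.ball α0 r ⊆ s ∩ {α | ∀ j, HasFDerivAt (fun β => g β j)
      (∑ i, F j i α • (ContinuousLinearMap.proj i : (Fin d → ℝ) →L[ℝ] ℝ)) α} :=
    (Metric.ball_subset_ball (min_le_left _ _)).trans hball'
  set B : ℝ := ∑ j, ∑ i, |F j i α0| + K with hB
  have hB0 : 0 ≤ B := by positivity
  have hFB : ∀ α ∈ Metric.ball α0 r, ∀ j i, |F j i α| ≤ B := by
    intro α hα j i
    have h1 := (hlip j i).2 α (hball hα).1 α0 (hball (Metric.mem_ball_self hr0)).1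
    have h2 : ‖α - α0‖ ≤ 1 := by
      rw [← dist_eq_norm]
      exact (Metric.mem_ball.mp hα).le.trans (min_le_right _ _)
    have h3 : |F j i α0| ≤ ∑ j, ∑ i, |F j i α0| :=
      (Finset.single_le_sum (f := fun i => |F j i α0|) (fun _ _ => by positivity)
            (Finset.mem_univ i)).trans
        (Finset.single_le_sum (f := fun j => ∑ i, |F j i α0|) (fun _ _ => by positivity)
            (Finset.mem_univ j))
    have h4 : |F j i α| ≤ |F j i α0| + |F j i α - F j i α0| := by
      have := abs_add_le (F j i α0) (F j i α - F j i α0)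
      rwa [add_sub_cancel] at this
    have h5 : K * ‖α - α0‖ ≤ K := mul_le_of_le_one_right hK h2
    linarith
  have hproj : ∀ (c : Fin d → ℝ) (b : ℝ), 0 ≤ b → (∀ i, |c i| ≤ b) →
      ‖∑ i, c i • (ContinuousLinearMap.proj i : (Fin d → ℝ) →L[ℝ] ℝ)‖ ≤ d * b := by
    intro c b hb hc
    refine ContinuousLinearMap.opNorm_le_bound _ (by positivity) fun v => ?_
    simp only [sum_apply, smul_apply, ContinuousLinearMap.proj_apply, smul_eq_mul]
    calc ‖∑ i, c i * v i‖ ≤ ∑ i, ‖c i * v i‖ := norm_sum_le _ _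
      _ ≤ ∑ _i : Fin d, b * ‖v‖ := by
          refine Finset.sum_le_sum fun i _ => ?_
          rw [norm_mul]
          exact mul_le_mul (hc i) (norm_le_pi_norm v i) (norm_nonneg _) hb
      _ = d * b * ‖v‖ := by simp; ring
  refine ⟨r, hr0, max 1 (d * max B K), le_max_left _ _,
    fun j i => (hlip j i).1.mono fun x hx => (hball hx).1, fun α hα β hβ j => ⟨?_, ?_⟩⟩
  · have h1 := (convex_ball α0 r).norm_image_sub_le_of_norm_hasFDerivWithin_le
      (f := fun β => g β j) (C := d * B)
      (fun x hx => ((hball hx).2 j).hasFDerivWithinAt)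
      (fun x hx => hproj _ B hB0 (hFB x hx j)) hα hβ
    rw [Real.norm_eq_abs] at h1
    refine h1.trans ?_
    gcongr
    refine le_trans ?_ (le_max_right _ _)
    gcongr
    exact le_max_left _ _
  -- On this convex set the gradient differs from its value at α by O(‖β - α‖), so the mean value
  -- inequality gives the quadratic error.
  · have h1 := ((convex_ball α0 r).inter
      (convex_closedBall α ‖β - α‖)).norm_image_sub_le_of_norm_hasFDerivWithin_le'
      (f := fun β => g β j) (C := d * (K * ‖β - α‖))
      (φ := ∑ i, F j i α • (ContinuousLinearMap.proj i : (Fin d → ℝ) →L[ℝ] ℝ))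
      (fun x hx => ((hball hx.1).2 j).hasFDerivWithinAt)
      (fun x hx => by
        rw [← Finset.sum_sub_distrib]
        simp_rw [← sub_smul]
        refine hproj _ _ (by positivity) fun i => ?_
        refine ((hlip j i).2 x (hball hx.1).1 α (hball hα).1).trans ?_
        have := Metric.mem_closedBall.mp hx.2
        rw [dist_eq_norm] at this
        gcongr)
      ⟨hα, Metric.mem_closedBall_self (norm_nonneg _)⟩
      ⟨hβ, by rw [Metric.mem_closedBall, dist_eq_norm]⟩
    simp only [sum_apply, smul_apply, ContinuousLinearMap.proj_apply, smul_eq_mul,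
      Pi.sub_apply, Real.norm_eq_abs] at h1
    refine h1.trans ?_
    calc d * (K * ‖β - α‖) * ‖β - α‖ = d * K * ‖β - α‖ ^ 2 := by ring
      _ ≤ _ := by
        gcongr
        refine le_trans ?_ (le_max_right _ _)
        gcongr
        exact le_max_right _ _

/-- The number of shifted integer points `(a + θ)/q` in a small cube around `α` at which `q g` is
close to a shifted integer vector. -/
lemma card_cube_le {d m : ℕ} {g : (Fin d → ℝ) → Fin m → ℝ} {A : Fin m → Fin d → ℝ}
    {α θ : Fin d → ℝ} {η : Fin m → ℝ} {q N H : ℕ} {L δ κ : ℝ} (hq : 0 < q) (hH : 0 < H)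
    (hL : 0 ≤ L) (P : Finset (Fin d → ℤ))
    (hP : ∀ a ∈ P, ∀ j, ∃ b : ℤ,
      |q * g (fun i => (a i + θ i) / q) j - η j - b| ≤ κ)
    (hα : ∀ a ∈ P, ‖(fun i => (a i + θ i) / q) - α‖ ≤ N / (2 * q))
    (hlin : ∀ a ∈ P, ∀ j, |g (fun i => (a i + θ i) / q) j - g α j -
      ∑ i, A j i * ((a i + θ i) / q - α i)| ≤ L * ‖(fun i => (a i + θ i) / q) - α‖ ^ 2)
    (hN : L * N ^ 2 ≤ 4 * q * δ) (hHδ : κ + δ ≤ 1 / (6 * H)) :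
    (N : ℝ) ^ d * P.card ≤ (4 / (H : ℝ) ^ 2) ^ m *
      ∑ k : Fin m → Fin H × Fin H,
        ∏ i, ‖dirichletSum (2 * N) (∑ j, finDiff (k j) * A j i)‖ ^ 2 := by
  classical
  have hq' : (0 : ℝ) < q := by exact_mod_cast hq
  rcases P.eq_empty_or_nonempty with rfl | ⟨a0, ha0⟩
  · simp only [Finset.card_empty, Nat.cast_zero, mul_zero]
    positivity
  have hcard : P.card = (P.image fun a => a - a0).card :=
    (Finset.card_image_of_injective _ fun a b h => sub_left_injective h).symm
  rw [hcard]
  -- Differences from one counted point `a0` are integer vectors in the box of size N. The constant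
  -- term absorbs θ, η and the base point.
  refine card_close_le N hH
    (fun j => q * g α j + ∑ i, A j i * (a0 i + θ i - q * α i) - η j) A _ ?_ ?_
  · simp only [Finset.mem_image]
    rintro _ ⟨a, ha, rfl⟩ i
    have h1 := (norm_le_pi_norm _ i).trans (hα a ha)
    have h2 := (norm_le_pi_norm _ i).trans (hα a0 ha0)
    simp only [Pi.sub_apply, Real.norm_eq_abs] at h1 h2
    have h3 : |((a i + θ i) / q - α i) - ((a0 i + θ i) / q - α i)| ≤ N / q := by
      refine (abs_sub _ _).trans ((add_le_add h1 h2).trans (le_of_eq ?_))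
      field_simp
      norm_num
    have h4 : ((a i + θ i) / q - α i) - ((a0 i + θ i) / q - α i) = ((a i : ℝ) - a0 i) / q := by
      field_simp
      ring
    rw [h4, abs_div, abs_of_pos hq', div_le_div_iff_of_pos_right hq'] at h3
    simp only [Pi.sub_apply]
    exact_mod_cast h3
  · simp only [Finset.mem_image]
    rintro _ ⟨a, ha, rfl⟩ j
    obtain ⟨b, hb⟩ := hP a ha j
    refine ⟨b, le_trans ?_ hHδ⟩
    have h1 := hlin a ha j
    have h2 : L * ‖(fun i => (a i + θ i) / q) - α‖ ^ 2 ≤ δ / q := by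
      calc L * ‖(fun i => (a i + θ i) / q) - α‖ ^ 2 ≤ L * (N / (2 * q)) ^ 2 := by
            gcongr
            exact hα a ha
        _ = (L * N ^ 2) / (4 * q ^ 2) := by field_simp; norm_num
        _ ≤ (4 * q * δ) / (4 * q ^ 2) := by gcongr
        _ = δ / q := by field_simp
    have h3 := h1.trans h2
    rw [le_div_iff₀ hq', ← abs_of_pos hq', ← abs_mul, abs_of_pos hq'] at h3
    have h4 : (q * g α j + ∑ i, A j i * (a0 i + θ i - q * α i) - η j) +
        ∑ i, A j i * ((a - a0) i : ℤ) - b =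
        (q * g (fun i => (a i + θ i) / q) j - η j - b) -
          (g (fun i => (a i + θ i) / q) j - g α j -
            ∑ i, A j i * ((a i + θ i) / q - α i)) * q := by
      have h5 : (∑ i, A j i * ((a i + θ i) / q - α i)) * q =
          ∑ i, A j i * (a0 i + θ i - q * α i) + ∑ i, A j i * ((a - a0) i : ℤ) := by
        rw [Finset.sum_mul, ← Finset.sum_add_distrib]
        refine Finset.sum_congr rfl fun i _ => ?_
        simp only [Pi.sub_apply, Int.cast_sub]
        field_simp
        ring
      rw [sub_mul, h5]
      ring
    rw [h4]
    exact (abs_sub _ _).trans (add_le_add hb h3)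

/-- Double counting: the point `p a` is seen from exactly those α in a cube of volume (2s)^d around
it, so integrating the pointwise bound over α bounds the whole count. -/
lemma mul_card_le_of_cubes {d : ℕ} {ι κ : Type*} [Fintype κ] (P : Finset ι)
    (p : ι → Fin d → ℝ) {s : ℝ} (hs : 0 ≤ s) {B : Set (Fin d → ℝ)} (hB : MeasurableSet B)
    (hp : ∀ a ∈ P, Metric.closedBall (p a) s ⊆ B) {D E : ℝ} (hD : 0 ≤ D) (hE : 0 ≤ E)
    {W : κ → (Fin d → ℝ) → ℝ} (hW0 : ∀ k α, 0 ≤ W k α) (hWc : ∀ k, ContinuousOn (W k) B)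
    {J : κ → ℝ} (hJ0 : ∀ k, 0 ≤ J k) (hJ : ∀ k, ∫⁻ α in B, ENNReal.ofReal (W k α) ≤ ENNReal.ofReal (J k))
    (hle : ∀ α ∈ B, ∀ Q : Finset ι, Q ⊆ P → (∀ a ∈ Q, α ∈ Metric.closedBall (p a) s) →
      D * Q.card ≤ E * ∑ k, W k α) :
    D * (P.card * (2 * s) ^ d) ≤ E * ∑ k, J k := by
  classical
  have hJs : 0 ≤ ∑ k, J k := Finset.sum_nonneg fun k _ => hJ0 k
  rw [← ENNReal.ofReal_le_ofReal_iff (mul_nonneg hE hJs)]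
  have hm : ∀ a, MeasurableSet (Metric.closedBall (p a) s) := fun a =>
    Metric.isClosed_closedBall.measurableSet
  have h1 : ENNReal.ofReal (D * (P.card * (2 * s) ^ d)) =
      ∫⁻ α in B, ENNReal.ofReal D *
        ∑ a ∈ P, (Metric.closedBall (p a) s).indicator (fun _ => (1 : ENNReal)) α := by
    rw [lintegral_const_mul _ (Finset.measurable_sum _ fun a _ =>
        measurable_const.indicator (hm a)),
      lintegral_finsetSum _ fun a _ => measurable_const.indicator (hm a),
      ENNReal.ofReal_mul hD]
    congr 1
    rw [Finset.sum_congr rfl (g := fun _ => ENNReal.ofReal ((2 * s) ^ d))]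
    · rw [Finset.sum_const, nsmul_eq_mul, ENNReal.ofReal_mul (by positivity),
        ENNReal.ofReal_natCast]
    · intro a ha
      rw [lintegral_indicator (hm a), setLIntegral_one, Measure.restrict_apply (hm a),
        Set.inter_eq_left.mpr (hp a ha), Real.volume_pi_closedBall _ hs, Fintype.card_fin]
  rw [h1]
  calc _ ≤ ∫⁻ α in B, ENNReal.ofReal E * ∑ k, ENNReal.ofReal (W k α) := by
        refine setLIntegral_mono' hB fun α hα => ?_
        have h2 := hle α hα (P.filter fun a => α ∈ Metric.closedBall (p a) s)
          (Finset.filter_subset _ _) fun a ha => (Finset.mem_filter.mp ha).2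
        have h3 : ∑ a ∈ P, (Metric.closedBall (p a) s).indicator (fun _ => (1 : ENNReal)) α =
            ((P.filter fun a => α ∈ Metric.closedBall (p a) s).card : ENNReal) := by
          simp only [Set.indicator_apply, Finset.sum_boole]
        rw [h3, ← ENNReal.ofReal_natCast, ← ENNReal.ofReal_mul hD,
          ← ENNReal.ofReal_sum_of_nonneg fun k _ => hW0 k α, ← ENNReal.ofReal_mul hE]
        exact ENNReal.ofReal_le_ofReal h2
    _ = ENNReal.ofReal E * ∑ k, ∫⁻ α in B, ENNReal.ofReal (W k α) := by
        have hWm : ∀ k, AEMeasurable (fun α => ENNReal.ofReal (W k α)) (volume.restrict B) :=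
          fun k => ((hWc k).aemeasurable hB).ennreal_ofReal
        rw [lintegral_const_mul'' _ (Finset.aemeasurable_fun_sum _ fun k _ => hWm k),
          lintegral_finsetSum' _ fun k _ => hWm k]
    _ ≤ ENNReal.ofReal E * ∑ k, ENNReal.ofReal (J k) := by
        gcongr with k
        exact hJ k
    _ = _ := by
        rw [ENNReal.ofReal_mul hE, ENNReal.ofReal_sum_of_nonneg fun k _ => hJ0 k]

lemma finite_shifted_lattice_mem_ball {d : ℕ} (α0 θ : Fin d → ℝ) {q : ℕ} (hq : 0 < q) (R : ℝ) :
    {a : Fin d → ℤ | (fun i => ((a i : ℝ) + θ i) / q) ∈ Metric.ball α0 R}.Finite := by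
  have hq' : (0 : ℝ) < q := by exact_mod_cast hq
  refine (Set.finite_Icc (fun i => ⌊q * (α0 i - R) - θ i⌋) (fun i => ⌈q * (α0 i + R) - θ i⌉)).subset
    fun a ha => ?_
  have ha' : ∀ i, |(a i + θ i) / q - α0 i| < R := by
    intro i
    have h1 := norm_le_pi_norm ((fun i => ((a i : ℝ) + θ i) / q) - α0) i
    simp only [Pi.sub_apply, Real.norm_eq_abs] at h1
    refine h1.trans_lt ?_
    rw [← dist_eq_norm]
    exact ha
  refine ⟨fun i => ?_, fun i => ?_⟩
  · have h2 := (abs_lt.mp (ha' i)).1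
    have h3 : α0 i - R < (a i + θ i) / q := by linarith
    rw [lt_div_iff₀ hq'] at h3
    refine Int.floor_le_iff.mpr ?_
    linarith
  · have h2 := (abs_lt.mp (ha' i)).2
    have h3 : (a i + θ i) / q < α0 i + R := by linarith
    rw [div_lt_iff₀ hq'] at h3
    refine Int.le_ceil_iff.mpr ?_
    linarith

/-- The diagonal tuples are those of frequency zero and give the main term. The rest are bounded by
the number of all tuples. -/
lemma sum_ite_finDiff_le {m H : ℕ} {x y : ℝ} (hy : 0 ≤ y) :
    ∑ k : Fin m → Fin H × Fin H, (if ∀ j, (k j).1 = (k j).2 then x else y) ≤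
      (H : ℝ) ^ m * x + ((H : ℝ) ^ 2) ^ m * y := by
  rw [Finset.sum_ite, Finset.sum_const, Finset.sum_const, card_finDiff_eq_zero, nsmul_eq_mul,
    nsmul_eq_mul]
  gcongr ?_ + ?_ * y
  · push_cast
    exact le_rfl
  · calc ((Finset.univ.filter fun k : Fin m → Fin H × Fin H => ¬ ∀ j, (k j).1 = (k j).2).card : ℝ)
        ≤ (Finset.univ : Finset (Fin m → Fin H × Fin H)).card := by
          exact_mod_cast Finset.card_le_card (Finset.filter_subset _ _)
      _ = ((H : ℝ) ^ 2) ^ m := by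
          simp [Finset.card_univ, sq]

lemma exists_nat_mul_sq_between {L x : ℝ} (hL : 0 < L) (hx : L ≤ x) :
    ∃ N : ℕ, 0 < N ∧ L * (N : ℝ) ^ 2 ≤ 4 * x ∧ x ≤ L * (N : ℝ) ^ 2 := by
  have hx0 : 0 < x := hL.trans_le hx
  have h1 : 1 ≤ Real.sqrt (x / L) := by rwa [Real.one_le_sqrt, one_le_div hL]
  have hsq : Real.sqrt (x / L) ^ 2 = x / L := Real.sq_sqrt (by positivity)
  have hc1 := Nat.le_ceil (Real.sqrt (x / L))
  have hc2 := Nat.ceil_lt_add_one (a := Real.sqrt (x / L)) (by positivity)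
  set N := ⌈Real.sqrt (x / L)⌉₊
  have e1 : (N : ℝ) ^ 2 ≤ 4 * (x / L) := by
    rw [← hsq]
    nlinarith
  have e2 : x / L ≤ (N : ℝ) ^ 2 := by
    rw [← hsq]
    gcongr
  refine ⟨N, ?_, ?_, ?_⟩
  · have : (0 : ℝ) < N := by linarith
    exact_mod_cast this
  · calc L * (N : ℝ) ^ 2 ≤ L * (4 * (x / L)) := by gcongr
      _ = 4 * x := by field_simp
  · rwa [div_le_iff₀' hL] at e2

lemma exists_nat_one_div_between {y : ℝ} (hy : 0 < y) (hy1 : 6 * y ≤ 1) :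
    ∃ H : ℕ, 0 < H ∧ y ≤ 1 / (6 * H) ∧ 1 / (H : ℝ) ≤ 12 * y := by
  set x := 1 / (6 * y) with hx
  have hx1 : 1 ≤ x := by rwa [hx, one_le_div (by positivity)]
  have hf1 : (⌊x⌋₊ : ℝ) ≤ x := Nat.floor_le (by positivity)
  have hf2 : x < ⌊x⌋₊ + 1 := Nat.lt_floor_add_one x
  have hf3 : 1 ≤ ⌊x⌋₊ := Nat.one_le_floor_iff _ |>.mpr hx1
  have hf4 : (1 : ℝ) ≤ ⌊x⌋₊ := by exact_mod_cast hf3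
  refine ⟨⌊x⌋₊, hf3, ?_, ?_⟩
  · rw [le_div_iff₀ (by positivity)]
    rw [hx, le_div_iff₀ (by positivity)] at hf1
    linarith
  · rw [div_le_iff₀ (by positivity)]
    have h1 : x * (6 * y) = 1 := by rw [hx]; field_simp
    have h2 : x ≤ 2 * (⌊x⌋₊ : ℝ) := by linarith
    have h3 : x * (6 * y) ≤ 2 * (⌊x⌋₊ : ℝ) * (6 * y) := by gcongr
    linarith

lemma le_of_mul_le_fejer_bound {d m ρ : ℕ} {X N H q C V : ℝ} (hN : 0 < N) (hH : 0 < H)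
    (hq : 0 < q) (h : N ^ d * (X * (N / q) ^ d) ≤ (4 / H ^ 2) ^ m *
      (H ^ m * ((2 * N) ^ (2 * d) * V) + (H ^ 2) ^ m * (C * (2 * N) ^ (2 * d) / (2 * N) ^ ρ))) :
    X ≤ q ^ d * (4 ^ d * 4 ^ m * (V * (1 / H ^ m) + C * (1 / (2 * N) ^ ρ))) := by
  have e1 : (2 * N) ^ (2 * d) = 4 ^ d * N ^ (2 * d) := by
    rw [mul_pow, pow_mul 2 2 d]
    norm_num
  have e2 : N ^ d * (X * (N / q) ^ d) = X / q ^ d * N ^ (2 * d) := by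
    rw [div_pow, two_mul, pow_add]
    ring
  have e3 : (4 / H ^ 2) ^ m * (H ^ 2) ^ m = 4 ^ m := by
    rw [← mul_pow, div_mul_cancel₀ _ (by positivity)]
  have e4 : (4 / H ^ 2) ^ m * H ^ m = 4 ^ m * (1 / H ^ m) := by
    rw [← mul_pow, ← one_div_pow, ← mul_pow]
    congr 1
    field_simp
  rw [mul_add, ← mul_assoc (_ ^ m) (H ^ m), ← mul_assoc (_ ^ m) ((H ^ 2) ^ m), e3, e4, e1, e2] at h
  have hN2 : 0 < N ^ (2 * d) := by positivity
  have h5 : X / q ^ d ≤ 4 ^ d * 4 ^ m * (V * (1 / H ^ m) + C * (1 / (2 * N) ^ ρ)) := by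
    refine le_of_mul_le_mul_right (h.trans (le_of_eq ?_)) hN2
    ring
  rwa [div_le_iff₀' (by positivity)] at h5

/-! ### The local volume estimate. -/

/-- The set of `α` such that `‖qα - θ‖ < δ` and `‖q g(α) - η‖ < δ`. -/
def closeSet {d m : ℕ} (g : (Fin d → ℝ) → Fin m → ℝ) (θ : Fin d → ℝ) (η : Fin m → ℝ)
    (q : ℕ) (δ : ℝ) : Set (Fin d → ℝ) :=
  {α | (∃ a : Fin d → ℤ, ∀ i, |q * α i - θ i - a i| < δ) ∧
    ∀ j, ∃ b : ℤ, |q * g α j - η j - b| < δ}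

lemma exists_volume_closeSet_le {d m ρ : ℕ} {α0 : Fin d → ℝ} {g : (Fin d → ℝ) → Fin m → ℝ}
    {F : Fin m → Fin d → (Fin d → ℝ) → ℝ} {G : Fin m → Fin d → (Fin d → ℝ) →L[ℝ] ℝ}
    (hg : ∀ᶠ α in nhds α0, ∀ j, HasFDerivAt (fun β => g β j)
      (∑ i, F j i α • (ContinuousLinearMap.proj i : (Fin d → ℝ) →L[ℝ] ℝ)) α)
    (hF : ∀ j i, HasStrictFDerivAt (F j i) (G j i) α0)
    (hrank : ∀ t : Fin m → ℝ, t ≠ 0 →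
      ρ ≤ (Matrix.of fun i k => ∑ j, t j * G j i (Pi.single k 1)).rank) :
    ∃ r > 0, ∃ C : ℝ, ∃ δ0 > 0, ∃ Q : ℝ, ∀ (q : ℕ) (δ : ℝ), 0 < q → 0 < δ → δ ≤ δ0 →
      Q ≤ q * δ → 1 ≤ δ ^ (2 * m) * (q * δ) ^ ρ → ∀ θ η,
        volume (closeSet g θ η q δ ∩ Metric.ball α0 r) ≤ ENNReal.ofReal (C * δ ^ (d + m)) := by
  classical
  obtain ⟨r1, hr1, L, hL, hcont, hlin⟩ := exists_ball_linearization hg hF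
  obtain ⟨r2, hr2, C, hC⟩ := exists_ball_lintegral_fejer_le hF hrank
  set R := min r1 r2 with hR
  have hR0 : 0 < R := lt_min hr1 hr2
  have hsub1 : Metric.ball α0 R ⊆ Metric.ball α0 r1 := Metric.ball_subset_ball (min_le_left _ _)
  have hsub2 : Metric.ball α0 R ⊆ Metric.ball α0 r2 := Metric.ball_subset_ball (min_le_right _ _)
  have hL0 : 0 < L := by linarith
  -- Nested radii: α lies within R/2, its lattice point within 3R/4 because δ/q ≤ R/4, and the
  -- averaging cubes within R because s ≤ R/4. The last two bounds on δ provide this room; the first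
  -- makes H ≥ 1 possible.
  refine ⟨R / 2, by positivity,
    2 ^ d * (4 ^ d * 4 ^ m * ((2 * R) ^ d * (12 * (2 + L)) ^ m + C * L ^ ρ)),
    min (1 / (6 * (2 + L))) (min (R / 4) (R ^ 2 / 16)), by positivity, L,
    fun q δ hq hδ hδ0 hQ hqδ θ η => ?_⟩
  have hq' : (0 : ℝ) < q := by exact_mod_cast hq
  have hq1 : (1 : ℝ) ≤ q := by exact_mod_cast hq
  have hδ1 : δ ≤ 1 / (6 * (2 + L)) := hδ0.trans (min_le_left _ _)
  have hδ2 : δ ≤ R / 4 := hδ0.trans ((min_le_right _ _).trans (min_le_left _ _))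
  have hδ3 : δ ≤ R ^ 2 / 16 := hδ0.trans ((min_le_right _ _).trans (min_le_right _ _))
  obtain ⟨N, hN0, hN1, hN2⟩ : ∃ N : ℕ, 0 < N ∧ L * (N : ℝ) ^ 2 ≤ 4 * q * δ ∧
      q * δ ≤ L * (N : ℝ) ^ 2 := by
    rw [mul_assoc]
    exact exists_nat_mul_sq_between hL0 hQ
  -- Of the tolerance (2 + L)δ, a part (1 + L)δ comes from moving α to its lattice point and δ from
  -- the linearisation.
  obtain ⟨H, hH0, hH1, hH2⟩ : ∃ H : ℕ, 0 < H ∧ (2 + L) * δ ≤ 1 / (6 * H) ∧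
      1 / (H : ℝ) ≤ 12 * (2 + L) * δ := by
    rw [mul_assoc]
    refine exists_nat_one_div_between (by positivity) ?_
    rw [le_div_iff₀ (by positivity)] at hδ1
    linarith
  have hN' : (0 : ℝ) < N := by exact_mod_cast hN0
  have hH' : (0 : ℝ) < H := by exact_mod_cast hH0
  set s : ℝ := N / (2 * q) with hs
  have hsR : s ≤ R / 4 := by
    have h1 : s ^ 2 ≤ (R / 4) ^ 2 := by
      rw [hs, div_pow, div_le_iff₀ (by positivity)]
      have h2 : (N : ℝ) ^ 2 ≤ L * (N : ℝ) ^ 2 := le_mul_of_one_le_left (by positivity) hL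
      have h3 : 4 * q * δ ≤ 4 * q * (R ^ 2 / 16) := by gcongr
      have h4 : 4 * q * (R ^ 2 / 16) ≤ 4 * (q * q) * (R ^ 2 / 16) := by
        gcongr
        exact le_mul_of_one_le_left hq'.le hq1
      nlinarith
    exact (abs_le_of_sq_le_sq' h1 (by positivity)).2
  let p : (Fin d → ℤ) → Fin d → ℝ := fun a i => ((a i : ℝ) + θ i) / q
  let Pset : Set (Fin d → ℤ) := {a | p a ∈ Metric.ball α0 (3 * R / 4)} ∩
    {a | ∀ j, ∃ b : ℤ, |q * g (p a) j - η j - b| ≤ (1 + L) * δ}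
  have hfin : Pset.Finite := (finite_shifted_lattice_mem_ball α0 θ hq _).inter_of_left _
  set P := hfin.toFinset with hP
  have hPmem : ∀ a, a ∈ P ↔ p a ∈ Metric.ball α0 (3 * R / 4) ∧
      ∀ j, ∃ b : ℤ, |q * g (p a) j - η j - b| ≤ (1 + L) * δ := fun a => by
    rw [hP, Set.Finite.mem_toFinset]
    exact Iff.rfl
  have hball34 : Metric.ball α0 (3 * R / 4) ⊆ Metric.ball α0 R :=
    Metric.ball_subset_ball (by linarith)
  have hcover : closeSet g θ η q δ ∩ Metric.ball α0 (R / 2) ⊆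
      ⋃ a ∈ P, Metric.closedBall (p a) (δ / q) := by
    rintro α ⟨⟨⟨a, ha⟩, hb⟩, hα⟩
    have hdist : ‖p a - α‖ ≤ δ / q := by
      refine (pi_norm_le_iff_of_nonneg (by positivity)).mpr fun i => ?_
      rw [Real.norm_eq_abs, le_div_iff₀ hq']
      have : (p a - α) i * q = -(q * α i - θ i - a i) := by
        simp only [p, Pi.sub_apply]
        field_simp
        ring
      rw [← abs_of_pos hq', ← abs_mul, this, abs_neg]
      exact (ha i).le
    have hpa : p a ∈ Metric.ball α0 (3 * R / 4) := by
      rw [Metric.mem_ball] at hα ⊢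
      have h1 : dist (p a) α ≤ R / 4 := by
        rw [dist_eq_norm]
        exact hdist.trans ((div_le_self hδ.le hq1).trans hδ2)
      linarith [dist_triangle (p a) α α0]
    refine Set.mem_iUnion₂.mpr ⟨a, (hPmem a).mpr ⟨hpa, fun j => ?_⟩, ?_⟩
    · obtain ⟨b, hb⟩ := hb j
      refine ⟨b, ?_⟩
      have h1 := (hlin α (hsub1 (Metric.ball_subset_ball (by linarith) hα)) (p a)
        (hsub1 (hball34 hpa)) j).1
      have h2 : |q * (g (p a) j - g α j)| ≤ L * δ := by
        rw [abs_mul, abs_of_pos hq']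
        calc q * |g (p a) j - g α j| ≤ q * (L * (δ / q)) := by
              gcongr
              exact h1.trans (by gcongr)
          _ = L * δ := by field_simp
      have h3 : q * g (p a) j - η j - b = (q * g α j - η j - b) + q * (g (p a) j - g α j) := by
        ring
      rw [h3]
      refine (abs_add_le _ _).trans ?_
      linarith
    · rw [Metric.mem_closedBall, dist_comm, dist_eq_norm]
      exact hdist
  set J : (Fin m → Fin H × Fin H) → ℝ := fun k =>
    if ∀ j, (k j).1 = (k j).2 then ((2 * N : ℕ) : ℝ) ^ (2 * d) * (2 * R) ^ d
    else C * ((2 * N : ℕ) : ℝ) ^ (2 * d) / ((2 * N : ℕ) : ℝ) ^ ρ with hJ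
  have hcard : (N : ℝ) ^ d * (P.card * (2 * s) ^ d) ≤ (4 / (H : ℝ) ^ 2) ^ m * ∑ k, J k := by
    refine mul_card_le_of_cubes (B := Metric.ball α0 R) P p (by positivity) measurableSet_ball
      ?_ (by positivity) (by positivity)
      (W := fun k α => ∏ i, ‖dirichletSum (2 * N) (∑ j, finDiff (k j) * F j i α)‖ ^ 2)
      (fun k α => by positivity) ?_ ?_ ?_ ?_
    · intro a ha x hx
      have h1 := ((hPmem a).mp ha).1
      rw [Metric.mem_ball] at h1 ⊢
      have := Metric.mem_closedBall.mp hx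
      linarith [dist_triangle x (p a) α0]
    · intro k
      refine continuousOn_finsetProd _ fun i _ => ContinuousOn.pow (ContinuousOn.norm ?_) 2
      refine (continuous_dirichletSum _).comp_continuousOn ?_
      exact continuousOn_finsetSum _ fun j _ =>
        continuousOn_const.mul ((hcont j i).mono hsub1)
    · intro k
      simp only [hJ]
      split_ifs <;> positivity
    · intro k
      simp only [hJ]
      split_ifs with hk
      · calc _ ≤ ∫⁻ α in Metric.ball α0 R, ENNReal.ofReal (((2 * N : ℕ) : ℝ) ^ (2 * d)) := by
              refine lintegral_mono fun α => ENNReal.ofReal_le_ofReal ?_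
              calc _ ≤ ∏ _i : Fin d, ((2 * N : ℕ) : ℝ) ^ 2 := by
                    gcongr
                    exact norm_dirichletSum_le _ _
                _ = _ := by rw [Finset.prod_const, Finset.card_univ, Fintype.card_fin, pow_mul]
          _ = _ := by
              rw [setLIntegral_const, Real.volume_pi_ball _ hR0, Fintype.card_fin,
                ← ENNReal.ofReal_mul (by positivity)]
      · have hnorm : 1 ≤ ‖fun j => finDiff (k j)‖ := by
          push Not at hk
          obtain ⟨j, hj⟩ := hk
          refine le_trans ?_ (norm_le_pi_norm _ j)
          rw [Real.norm_eq_abs, finDiff]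
          have : (1 : ℤ) ≤ |(((k j).1 : ℕ) : ℤ) - (((k j).2 : ℕ) : ℤ)| := by
            refine Int.one_le_abs (sub_ne_zero.mpr fun h => hj (Fin.ext ?_))
            exact_mod_cast h
          exact_mod_cast this
        have h1 := hC _ hnorm (2 * N) (by positivity)
        have h2N : (0 : ℝ) < ((2 * N : ℕ) : ℝ) := by positivity
        have hne0 : ((2 * N : ℕ) : ENNReal) ^ ρ ≠ 0 := by positivity
        rw [ENNReal.ofReal_div_of_pos (by positivity), ENNReal.le_div_iff_mul_le (Or.inl ?_) (Or.inl ?_), mul_comm,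
          ENNReal.ofReal_pow (by positivity), ENNReal.ofReal_mul (by positivity),
          ENNReal.ofReal_pow (by positivity), ENNReal.ofReal_natCast, ENNReal.ofReal_coe_nnreal]
        · refine le_trans ?_ h1
          gcongr
        · rw [ENNReal.ofReal_pow (by positivity), ENNReal.ofReal_natCast]
          exact hne0
        · exact ENNReal.ofReal_ne_top
    · intro α hα Q hQP hQ
      have hQ34 : ∀ a ∈ Q, p a ∈ Metric.ball α0 r1 := fun a ha =>
        hsub1 (hball34 ((hPmem a).mp (hQP ha)).1)
      refine card_cube_le (g := g) (α := α) (θ := θ) (η := η) (A := fun j i => F j i α) (L := L)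
        (δ := δ) (κ := (1 + L) * δ) hq hH0 hL0.le Q (fun a ha => ((hPmem a).mp (hQP ha)).2)
        (fun a ha => ?_) (fun a ha j => (hlin α (hsub1 hα) (p a) (hQ34 a ha) j).2) hN1 (by linarith)
      have := Metric.mem_closedBall.mp (hQ a ha)
      rwa [dist_comm, dist_eq_norm] at this
  -- The nonzero frequencies are no larger than the main term: this is the square root of the
  -- condition on δ, with qδ replaced by L N².
  have hNρ : 1 / ((2 * N : ℕ) : ℝ) ^ ρ ≤ L ^ ρ * δ ^ m := by
    have h1 : 1 ≤ ((N : ℝ) ^ ρ * (L ^ ρ * δ ^ m)) ^ 2 := by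
      calc (1 : ℝ) ≤ δ ^ (2 * m) * (q * δ) ^ ρ := hqδ
        _ ≤ δ ^ (2 * m) * (L * (N : ℝ) ^ 2) ^ ρ := by gcongr
        _ ≤ δ ^ (2 * m) * (L ^ 2 * (N : ℝ) ^ 2) ^ ρ := by
            gcongr
            nlinarith
        _ = _ := by ring
    have h2 : 1 ≤ (N : ℝ) ^ ρ * (L ^ ρ * δ ^ m) := by
      rwa [one_le_sq_iff₀ (by positivity)] at h1
    rw [div_le_iff₀ (by positivity), mul_comm]
    refine h2.trans ?_
    gcongr
    omega
  have hHm : 1 / (H : ℝ) ^ m ≤ (12 * (2 + L)) ^ m * δ ^ m := by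
    rw [← one_div_pow, ← mul_pow]
    gcongr
  have hPcard : (P.card : ℝ) ≤ (q : ℝ) ^ d *
      (4 ^ d * 4 ^ m * ((2 * R) ^ d * (12 * (2 + L)) ^ m + C * L ^ ρ)) * δ ^ m := by
    have h1 := hcard.trans (mul_le_mul_of_nonneg_left
      (sum_ite_finDiff_le (m := m) (H := H)
        (x := ((2 * N : ℕ) : ℝ) ^ (2 * d) * (2 * R) ^ d)
        (y := C * ((2 * N : ℕ) : ℝ) ^ (2 * d) / ((2 * N : ℕ) : ℝ) ^ ρ)
        (by positivity)) (by positivity))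
    have h2 : 2 * s = N / q := by rw [hs]; field_simp
    rw [h2] at h1
    push_cast at h1 hNρ
    have h4 := le_of_mul_le_fejer_bound hN' hH' hq' h1
    refine h4.trans ?_
    calc (q : ℝ) ^ d * (4 ^ d * 4 ^ m *
          ((2 * R) ^ d * (1 / (H : ℝ) ^ m) + C * (1 / (2 * (N : ℝ)) ^ ρ)))
        ≤ (q : ℝ) ^ d * (4 ^ d * 4 ^ m *
        ((2 * R) ^ d * ((12 * (2 + L)) ^ m * δ ^ m) + C * (L ^ ρ * δ ^ m))) := by gcongr
      _ = _ := by ring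
  calc volume (closeSet g θ η q δ ∩ Metric.ball α0 (R / 2))
      ≤ ∑ a ∈ P, volume (Metric.closedBall (p a) (δ / q)) :=
        (measure_mono hcover).trans (measure_biUnion_finset_le _ _)
    _ = ENNReal.ofReal (P.card * (2 * (δ / q)) ^ d) := by
        have hvol : ∀ a, volume (Metric.closedBall (p a) (δ / q)) =
            ENNReal.ofReal ((2 * (δ / q)) ^ d) := fun a => by
          rw [Real.volume_pi_closedBall (p a) (div_nonneg hδ.le hq'.le), Fintype.card_fin]
        simp only [hvol]
        rw [Finset.sum_const, nsmul_eq_mul, ENNReal.ofReal_mul (Nat.cast_nonneg _),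
          ENNReal.ofReal_natCast]
    _ ≤ _ := by
        refine ENNReal.ofReal_le_ofReal ?_
        generalize 4 ^ d * 4 ^ m * ((2 * R) ^ d * (12 * (2 + L)) ^ m + C * L ^ ρ) = c at hPcard ⊢
        calc (P.card : ℝ) * (2 * (δ / q)) ^ d ≤ ((q : ℝ) ^ d * c * δ ^ m) * (2 * (δ / q)) ^ d := by
              gcongr
          _ = 2 ^ d * c * δ ^ (d + m) := by
            rw [mul_pow, div_pow, pow_add]
            field_simp

lemma closeSet_mono {d m : ℕ} (g : (Fin d → ℝ) → Fin m → ℝ) (θ : Fin d → ℝ) (η : Fin m → ℝ)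
    (q : ℕ) {δ δ' : ℝ} (h : δ ≤ δ') : closeSet g θ η q δ ⊆ closeSet g θ η q δ' := by
  rintro α ⟨⟨a, ha⟩, hb⟩
  refine ⟨⟨a, fun i => (ha i).trans_le h⟩, fun j => ?_⟩
  obtain ⟨b, hb⟩ := hb j
  exact ⟨b, hb.trans_le h⟩

/-! ### The majorant and Borel–Cantelli. -/

/-- Raising `ψ` to a small negative power of `q` keeps it summable and makes the error terms of
the volume estimate negligible. -/
lemma exists_majorant {d m ρ : ℕ} (hm : 0 < m) (hρ : 2 * m + ρ < ρ * (d + m)) {ψ : ℕ → ℝ≥0}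
    (hψ : Summable fun q : ℕ => ψ (q + 1) ^ (d + m)) :
    ∃ φ : ℕ → ℝ, (∀ q, (ψ q : ℝ) ≤ φ q) ∧ (Summable fun q => φ q ^ (d + m)) ∧
      Filter.Tendsto φ Filter.atTop (nhds 0) ∧
      Filter.Tendsto (fun q : ℕ => q * φ q) Filter.atTop Filter.atTop ∧
      ∀ q : ℕ, 0 < q → 0 < φ q ∧ 1 ≤ φ q ^ (2 * m) * (q * φ q) ^ ρ := by
  have hn : d + m ≠ 0 := by omega
  -- The exponent for which δ = q^(-κ) gives δ^(2m) (qδ)^ρ = 1. Here κ < 1 gives qδ → ∞, and `hρ`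
  -- says that κ(d + m) > 1.
  set κ : ℝ := ρ / (2 * m + ρ) with hκ
  have hρ0 : (0 : ℝ) < ρ := by
    have : 0 < ρ := Nat.pos_of_ne_zero fun h => by simp [h] at hρ
    exact_mod_cast this
  have hm0 : (0 : ℝ) < m := by exact_mod_cast hm
  have hden : (0 : ℝ) < 2 * m + ρ := by positivity
  have hκ0 : 0 < κ := by positivity
  have hκ1 : κ < 1 := by
    rw [hκ, div_lt_one hden]
    linarith
  have hψ' : Summable fun q : ℕ => (ψ q : ℝ) ^ (d + m) := by
    have h1 := NNReal.summable_coe.mpr hψ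
    simp only [NNReal.coe_pow] at h1
    exact (summable_nat_add_iff (f := fun q => (ψ q : ℝ) ^ (d + m)) 1).mp h1
  have hpow : Summable fun q : ℕ => ((q : ℝ) ^ (-κ)) ^ (d + m) := by
    have h1 : ∀ q : ℕ, ((q : ℝ) ^ (-κ)) ^ (d + m) = (q : ℝ) ^ (-κ * ((d + m : ℕ) : ℝ)) := fun q => by
      rw [← Real.rpow_natCast, ← Real.rpow_mul (Nat.cast_nonneg q)]
    simp_rw [h1]
    rw [Real.summable_nat_rpow, neg_mul, neg_lt_neg_iff, hκ, div_mul_eq_mul_div, one_lt_div hden]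
    exact_mod_cast hρ
  have hψ0 : Filter.Tendsto (fun q => (ψ q : ℝ)) Filter.atTop (nhds 0) := by
    have h1 := hψ'.tendsto_atTop_zero
    have h2 := h1.rpow_const (p := ((d + m : ℕ) : ℝ)⁻¹) (Or.inr (by positivity))
    rw [Real.zero_rpow (by positivity)] at h2
    refine h2.congr fun q => ?_
    exact Real.pow_rpow_inv_natCast (ψ q).coe_nonneg hn
  have hpow0 : Filter.Tendsto (fun q : ℕ => (q : ℝ) ^ (-κ)) Filter.atTop (nhds 0) :=
    (tendsto_rpow_neg_atTop hκ0).comp tendsto_natCast_atTop_atTop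
  refine ⟨fun q => max (ψ q) ((q : ℝ) ^ (-κ)), fun q => le_max_left _ _, ?_, ?_, ?_, ?_⟩
  · refine Summable.of_nonneg_of_le (fun q => by positivity) (fun q => ?_) (hψ'.add hpow)
    dsimp only
    rcases max_choice (ψ q : ℝ) ((q : ℝ) ^ (-κ)) with h | h
    · rw [h]
      exact le_add_of_nonneg_right (by positivity)
    · rw [h]
      exact le_add_of_nonneg_left (by positivity)
  · simpa using hψ0.max hpow0
  · have h1 : Filter.Tendsto (fun q : ℕ => (q : ℝ) ^ (1 - κ)) Filter.atTop Filter.atTop :=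
      (tendsto_rpow_atTop (by linarith)).comp tendsto_natCast_atTop_atTop
    refine Filter.tendsto_atTop_mono' _ ?_ h1
    filter_upwards [Filter.eventually_gt_atTop 0] with q hq
    have hq' : (0 : ℝ) < q := by exact_mod_cast hq
    rw [sub_eq_add_neg, Real.rpow_add hq', Real.rpow_one]
    gcongr
    exact le_max_right _ _
  · intro q hq
    have hq' : (0 : ℝ) < q := by exact_mod_cast hq
    have hpos : 0 < (q : ℝ) ^ (-κ) := Real.rpow_pos_of_pos hq' _
    refine ⟨lt_max_of_lt_right hpos, ?_⟩
    have h1 : ((q : ℝ) ^ (-κ)) ^ (2 * m) * (q * (q : ℝ) ^ (-κ)) ^ ρ = 1 := by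
      have e1 : (q : ℝ) * (q : ℝ) ^ (-κ) = (q : ℝ) ^ (1 - κ) := by
        rw [sub_eq_add_neg, Real.rpow_add hq', Real.rpow_one]
      rw [e1, ← Real.rpow_natCast, ← Real.rpow_natCast, ← Real.rpow_mul hq'.le,
        ← Real.rpow_mul hq'.le, ← Real.rpow_add hq']
      have : -κ * ((2 * m : ℕ) : ℝ) + (1 - κ) * (ρ : ℝ) = 0 := by
        rw [hκ]
        push_cast
        field_simp
        ring
      rw [this, Real.rpow_zero]
    rw [← h1]
    gcongr <;> exact le_max_right _ _

lemma exists_volume_limsup_closeSet_eq_zero {d m ρ : ℕ} (hm : 0 < m)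
    (hρ : 2 * m + ρ < ρ * (d + m)) {α0 : Fin d → ℝ} {g : (Fin d → ℝ) → Fin m → ℝ}
    {F : Fin m → Fin d → (Fin d → ℝ) → ℝ} {G : Fin m → Fin d → (Fin d → ℝ) →L[ℝ] ℝ}
    (hg : ∀ᶠ α in nhds α0, ∀ j, HasFDerivAt (fun β => g β j)
      (∑ i, F j i α • (ContinuousLinearMap.proj i : (Fin d → ℝ) →L[ℝ] ℝ)) α)
    (hF : ∀ j i, HasStrictFDerivAt (F j i) (G j i) α0)
    (hrank : ∀ t : Fin m → ℝ, t ≠ 0 →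
      ρ ≤ (Matrix.of fun i k => ∑ j, t j * G j i (Pi.single k 1)).rank)
    {ψ : ℕ → ℝ≥0} (hψ : Summable fun q : ℕ => ψ (q + 1) ^ (d + m))
    (θ : Fin d → ℝ) (η : Fin m → ℝ) :
    ∃ r > 0, volume ({α | ∃ᶠ q in Filter.atTop, α ∈ closeSet g θ η q (ψ q)} ∩
      Metric.ball α0 r) = 0 := by
  obtain ⟨r, hr, C, δ0, hδ0, Q, hvol⟩ := exists_volume_closeSet_le hg hF hrank
  obtain ⟨φ, hψφ, hφsum, hφ0, hφtop, hφ⟩ := exists_majorant hm hρ hψ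
  refine ⟨r, hr, ?_⟩
  have hev : ∀ᶠ q : ℕ in Filter.atTop, 0 < q ∧ φ q ≤ δ0 ∧ Q ≤ q * φ q :=
    (Filter.eventually_gt_atTop 0).and
      ((hφ0.eventually_le_const hδ0).and (hφtop.eventually_ge_atTop Q))
  obtain ⟨q0, hq0⟩ := Filter.eventually_atTop.mp hev
  -- Including q0 ≤ q in the event empties the early sets, where the volume estimate may fail.
  have hBC : volume {α | ∃ᶠ q in Filter.atTop,
      q0 ≤ q ∧ α ∈ closeSet g θ η q (φ q) ∩ Metric.ball α0 r} = 0 := by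
    refine measure_setOfPred_frequently_eq_zero
      (p := fun q α => q0 ≤ q ∧ α ∈ closeSet g θ η q (φ q) ∩ Metric.ball α0 r) ?_
    refine ne_top_of_le_ne_top (hφsum.mul_left C).tsum_ofReal_ne_top
      (ENNReal.tsum_le_tsum fun q => ?_)
    by_cases hq : q0 ≤ q
    · obtain ⟨h1, h2, h3⟩ := hq0 q hq
      refine le_trans (measure_mono ?_)
        (hvol q (φ q) h1 (hφ q h1).1 h2 h3 (hφ q h1).2 θ η)
      exact fun α hα => hα.2
    · have : {α | q0 ≤ q ∧ α ∈ closeSet g θ η q (φ q) ∩ Metric.ball α0 r} = ∅ :=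
        Set.eq_empty_of_forall_notMem fun α hα => hq hα.1
      rw [this, measure_empty]
      exact zero_le
  refine measure_mono_null ?_ hBC
  rintro α ⟨hα, hαr⟩
  refine (hα.and_eventually (Filter.eventually_ge_atTop q0)).mono fun q hq => ?_
  exact ⟨hq.2, closeSet_mono g θ η q (hψφ q) hq.1, hαr⟩

/-! ### Transfer to Euclidean spaces and to the graph. -/

/-- The local statement for a map between Euclidean spaces. -/
lemma exists_volume_limsup_closeSet_eq_zero_of_contDiffAt {d m ρ : ℕ} (hm : 0 < m)
    (hρ : 2 * m + ρ < ρ * (d + m)) {f : EuclideanSpace ℝ (Fin d) → EuclideanSpace ℝ (Fin m)}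
    {α0 : Fin d → ℝ} (hf : ContDiffAt ℝ 2 f (WithLp.toLp 2 α0))
    (hrank : ∀ t : EuclideanSpace ℝ (Fin m), t ≠ 0 → ρ ≤ (Matrix.of fun i j => inner ℝ t
      (fderiv ℝ (fderiv ℝ f) (WithLp.toLp 2 α0) (stdVec i) (stdVec j))).rank)
    {ψ : ℕ → ℝ≥0} (hψ : Summable fun q : ℕ => ψ (q + 1) ^ (d + m))
    (θ : Fin d → ℝ) (η : Fin m → ℝ) :
    ∃ r > 0, volume ({α | ∃ᶠ q in Filter.atTop,
      α ∈ closeSet (fun β j => f (WithLp.toLp 2 β) j) θ η q (ψ q)} ∩ Metric.ball α0 r) = 0 := by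
  let e : (Fin d → ℝ) →L[ℝ] EuclideanSpace ℝ (Fin d) :=
    (PiLp.continuousLinearEquiv 2 ℝ fun _ : Fin d => ℝ).symm
  have he : ∀ α, e α = WithLp.toLp 2 α := fun α => rfl
  let π : Fin m → EuclideanSpace ℝ (Fin m) →L[ℝ] ℝ := fun j => EuclideanSpace.proj j
  have hev : ∀ᶠ α in nhds α0, ContDiffAt ℝ 2 f (e α) :=
    e.continuous.continuousAt.eventually (hf.eventually (by simp))
  refine exists_volume_limsup_closeSet_eq_zero (ρ := ρ) hm hρ
    (F := fun j i α => π j (fderiv ℝ f (e α) (stdVec i)))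
    (G := fun j i => (π j).comp (((ContinuousLinearMap.apply ℝ _ (stdVec i)).comp
      (fderiv ℝ (fderiv ℝ f) (e α0))).comp e)) ?_ ?_ ?_ hψ θ η
  · filter_upwards [hev] with α hα j
    have h1 : HasFDerivAt f (fderiv ℝ f (e α)) (e α) :=
      (hα.differentiableAt (by simp)).hasFDerivAt
    have h2 : HasFDerivAt (fun β => π j (f (e β))) ((π j).comp ((fderiv ℝ f (e α)).comp e)) α :=
      (π j).hasFDerivAt.comp α (h1.comp α e.hasFDerivAt)
    refine h2.congr_fderiv (ContinuousLinearMap.ext fun v => ?_)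
    have hv : e v = ∑ i, v i • stdVec i := by
      ext k
      simp [he, stdVec, Finset.sum_apply, Pi.single_apply]
    simp only [sum_apply, smul_apply, ContinuousLinearMap.proj_apply, smul_eq_mul,
      ContinuousLinearMap.comp_apply, hv, map_sum, map_smul]
    exact Finset.sum_congr rfl fun i _ => mul_comm _ _
  · intro j i
    have h1 : HasStrictFDerivAt (fderiv ℝ f) (fderiv ℝ (fderiv ℝ f) (e α0)) (e α0) :=
      (hf.fderiv_right (m := 1) (by norm_num)).hasStrictFDerivAt (by simp)
    have h2 := HasStrictFDerivAt.comp α0 h1 e.hasStrictFDerivAt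
    have h3 := HasStrictFDerivAt.comp α0
      (ContinuousLinearMap.apply ℝ (EuclideanSpace ℝ (Fin m)) (stdVec i)).hasStrictFDerivAt h2
    exact HasStrictFDerivAt.comp α0 (π j).hasStrictFDerivAt h3
  · intro t ht
    have h1 := hrank (WithLp.toLp 2 t) (by simpa using ht)
    -- Differentiating the i-th partial derivative along e_k gives f''[e_k, e_i], the transposed
    -- entry. Equality of row and column rank avoids using symmetry of f''.
    rw [← Matrix.rank_transpose] at h1
    refine h1.trans (le_of_eq (congrArg Matrix.rank ?_))
    ext i k
    have hk : e (Pi.single k 1) = stdVec k := rfl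
    simp only [Matrix.transpose_apply, Matrix.of_apply, ContinuousLinearMap.comp_apply, hk,
      PiLp.inner_apply, ContinuousLinearMap.apply_apply, ← he]
    refine Finset.sum_congr rfl fun j _ => ?_
    rw [real_inner_comm]
    rfl

lemma mem_closeSet_of_append_mem_approxSet {d m : ℕ}
    {f : EuclideanSpace ℝ (Fin d) → EuclideanSpace ℝ (Fin m)} {ψ : ℕ → ℝ≥0}
    {θ : EuclideanSpace ℝ (Fin (d + m))} {α : Fin d → ℝ}
    (h : WithLp.toLp 2 (Fin.append α (fun j => f (WithLp.toLp 2 α) j)) ∈ approxSet ψ θ) :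
    ∃ᶠ q in Filter.atTop, α ∈ closeSet (fun β j => f (WithLp.toLp 2 β) j)
      (fun i => θ (Fin.castAdd m i)) (fun j => θ (Fin.natAdd d j)) q (ψ q) := by
  rw [Nat.frequently_atTop_iff_infinite]
  refine Set.Infinite.mono ?_ h
  rintro q ⟨-, hq⟩
  obtain ⟨_, ⟨p, rfl⟩, hp⟩ := (Metric.infDist_lt_iff (Set.range_nonempty _)).mp hq
  have hp' : ∀ i, |q * Fin.append α (fun j => f (WithLp.toLp 2 α) j) i - θ i - p i| < ψ q := by
    intro i
    refine lt_of_le_of_lt ?_ hp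
    have := dist_le_pi_dist (fun i => ((q : ℝ) • WithLp.toLp 2
      (Fin.append α (fun j => f (WithLp.toLp 2 α) j)) - θ) i) (fun i => (p i : ℝ)) i
    rwa [Real.dist_eq] at this
  refine ⟨⟨fun i => p (Fin.castAdd m i), fun i => ?_⟩, fun j => ⟨p (Fin.natAdd d j), ?_⟩⟩
  · simpa using hp' (Fin.castAdd m i)
  · simpa using hp' (Fin.natAdd d j)

lemma isClosed_closedRect {d : ℕ} (a b : Fin d → ℝ) : IsClosed (closedRect a b) := by
  have : closedRect a b = ⋂ i, ({x | a i ≤ x i} ∩ {x | x i ≤ b i}) := by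
    ext x
    simp [closedRect]
  rw [this]
  exact isClosed_iInter fun i => (isClosed_le (by fun_prop) (by fun_prop)).inter
    (isClosed_le (by fun_prop) (by fun_prop))

lemma convex_closedRect {d : ℕ} (a b : Fin d → ℝ) : Convex ℝ (closedRect a b) := by
  have h1 : closedRect a b =
      (WithLp.linearEquiv 2 ℝ (Fin d → ℝ)).toLinearMap ⁻¹' Set.Icc a b := by
    ext x
    simp [closedRect, Pi.le_def, forall_and]
  rw [h1]
  exact (convex_Icc a b).linear_preimage _

lemma isCompact_closedRect {d : ℕ} (a b : Fin d → ℝ) : IsCompact (closedRect a b) := by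
  have h1 : closedRect a b = (PiLp.continuousLinearEquiv 2 ℝ fun _ : Fin d => ℝ).symm ''
      Set.Icc a b := by
    ext x
    constructor
    · intro hx
      exact ⟨fun i => x i, ⟨fun i => (hx i).1, fun i => (hx i).2⟩, rfl⟩
    · rintro ⟨y, hy, rfl⟩ i
      exact ⟨hy.1 i, hy.2 i⟩
  rw [h1]
  exact isCompact_Icc.image (ContinuousLinearEquiv.continuous _)

lemma closedRect_mem_nhds {d : ℕ} {a b : Fin d → ℝ} {x : EuclideanSpace ℝ (Fin d)}
    (hx : ∀ i, a i < x i ∧ x i < b i) : closedRect a b ∈ nhds x := by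
  have h1 : ∀ i, ∀ᶠ y : EuclideanSpace ℝ (Fin d) in nhds x, a i ≤ y i ∧ y i ≤ b i := by
    intro i
    have hc : Continuous fun y : EuclideanSpace ℝ (Fin d) => y i := by fun_prop
    filter_upwards [hc.continuousAt.eventually (lt_mem_nhds (hx i).1),
      hc.continuousAt.eventually (gt_mem_nhds (hx i).2)] with y h1 h2
    exact ⟨h1.le, h2.le⟩
  exact Filter.eventually_all.mpr h1

lemma uniqueDiffOn_closedRect {d : ℕ} {a b : Fin d → ℝ} (hab : ∀ i, a i < b i) :
    UniqueDiffOn ℝ (closedRect a b) := by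
  refine uniqueDiffOn_convex (convex_closedRect a b)
    ⟨WithLp.toLp 2 fun i => (a i + b i) / 2, mem_interior_iff_mem_nhds.mpr
      (closedRect_mem_nhds fun i => ?_)⟩
  have := hab i
  constructor <;> simp only <;> linarith

lemma exists_lipschitzOnWith_closedRect {d m : ℕ} {a b : Fin d → ℝ} (hab : ∀ i, a i < b i)
    {f : EuclideanSpace ℝ (Fin d) → EuclideanSpace ℝ (Fin m)}
    (hf : ContDiffOn ℝ 2 f (closedRect a b)) : ∃ C, LipschitzOnWith C f (closedRect a b) := by
  have h1 := hf.continuousOn_fderivWithin (uniqueDiffOn_closedRect hab) (by norm_num)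
  obtain ⟨C, hC⟩ := (isCompact_closedRect a b).exists_bound_of_continuousOn h1
  refine ⟨C.toNNReal, (convex_closedRect a b).lipschitzOnWith_of_nnnorm_fderivWithin_le (𝕜 := ℝ)
    (hf.differentiableOn (by norm_num)) fun x hx => ?_⟩
  rw [← NNReal.coe_le_coe, coe_nnnorm]
  exact (hC x hx).trans (Real.le_coe_toNNReal C)

/-- The graph map is Lipschitz on K, and d-dimensional Hausdorff measure for the max metric on the
parameter space is Lebesgue measure. -/
lemma hausdorffMeasure_image_graph_eq_zero {d m : ℕ} {K Z : Set (Fin d → ℝ)} (hZK : Z ⊆ K)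
    (hZ : volume Z = 0) {f : EuclideanSpace ℝ (Fin d) → EuclideanSpace ℝ (Fin m)} {C : ℝ≥0}
    (hf : LipschitzOnWith C f (WithLp.toLp 2 '' K)) :
    Measure.hausdorffMeasure (d : ℝ) ((fun α : Fin d → ℝ => (WithLp.toLp 2
      (Fin.append α fun j => f (WithLp.toLp 2 α) j) : EuclideanSpace ℝ (Fin (d + m)))) '' Z) =
      0 := by
  obtain ⟨D, h1⟩ : ∃ D, LipschitzOnWith D (fun α : Fin d → ℝ => f (WithLp.toLp 2 α)) K :=
    ⟨_, hf.comp ((PiLp.lipschitzWith_toLp 2 fun _ : Fin d => ℝ).lipschitzOnWith)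
      (Set.mapsTo_image _ _)⟩
  have h2 : LipschitzOnWith (max 1 D)
      (fun α : Fin d → ℝ => Fin.append α fun j => f (WithLp.toLp 2 α) j) K := by
    refine LipschitzOnWith.of_dist_le_mul fun x hx y hy => ?_
    refine (dist_pi_le_iff (by positivity)).mpr fun i => ?_
    refine Fin.addCases (fun i => ?_) (fun j => ?_) i
    · rw [Fin.append_left, Fin.append_left]
      refine (dist_le_pi_dist x y i).trans (le_mul_of_one_le_left dist_nonneg ?_)
      exact_mod_cast le_max_left _ _
    · rw [Fin.append_right, Fin.append_right]
      have h3 := h1.dist_le_mul x hx y hy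
      have h4 := (PiLp.lipschitzWith_ofLp 2 fun _ : Fin m => ℝ).dist_le_mul
        (f (WithLp.toLp 2 x)) (f (WithLp.toLp 2 y))
      rw [NNReal.coe_one, one_mul] at h4
      refine (dist_le_pi_dist _ _ j).trans (h4.trans (h3.trans ?_))
      gcongr
      exact le_max_right _ _
  have h3 := ((PiLp.lipschitzWith_toLp 2 fun _ : Fin (d + m) => ℝ).comp_lipschitzOnWith h2).mono hZK
  have h4 := h3.hausdorffMeasure_image_le (d := (d : ℝ)) (Nat.cast_nonneg d)
  have h5 : (Measure.hausdorffMeasure (d : ℝ) : Measure (Fin d → ℝ)) = volume := by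
    have := hausdorffMeasure_pi_real (ι := Fin d)
    rwa [Fintype.card_fin] at this
  rw [h5, hZ, mul_zero] at h4
  exact le_antisymm h4 zero_le

lemma secondDeriv_eq_of_mem_nhds {d m : ℕ} {K : Set (EuclideanSpace ℝ (Fin d))}
    (f : EuclideanSpace ℝ (Fin d) → EuclideanSpace ℝ (Fin m)) {x : EuclideanSpace ℝ (Fin d)}
    (hx : K ∈ nhds x) : secondDeriv K f x = fderiv ℝ (fderiv ℝ f) x := by
  rw [secondDeriv, fderivWithin_of_mem_nhds hx]
  refine Filter.EventuallyEq.fderiv_eq ?_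
  filter_upwards [eventually_mem_nhds_iff.mpr hx] with y hy
  exact fderivWithin_of_mem_nhds hy

/-- If t · f'' vanished, t would be orthogonal to the image of f'', which contains t itself. -/
lemma one_le_rank_dotSecondDeriv {d m : ℕ} {K : Set (EuclideanSpace ℝ (Fin d))}
    {f : EuclideanSpace ℝ (Fin d) → EuclideanSpace ℝ (Fin m)} {α : EuclideanSpace ℝ (Fin d)}
    (h : Function.Surjective (secondDerivSym K f α)) {t : EuclideanSpace ℝ (Fin m)}
    (ht : t ≠ 0) : 1 ≤ (dotSecondDeriv K f α t).rank := by
  by_contra hlt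
  have h0 : dotSecondDeriv K f α t = 0 := by
    have h1 : (dotSecondDeriv K f α t).rank = 0 := by omega
    rw [Matrix.rank, Submodule.finrank_eq_zero, LinearMap.range_eq_bot] at h1
    ext i j
    simpa using congrFun (LinearMap.congr_fun h1 (Pi.single j 1)) i
  obtain ⟨B, hB⟩ := h t
  have h2 : inner ℝ t t = (0 : ℝ) := by
    conv_lhs => rw [← hB]
    change inner ℝ (secondDerivSym K f α B) (∑ i, ∑ j, B.1 i j •
      secondDeriv K f α (stdVec i) (stdVec j)) = 0
    rw [hB, inner_sum]
    refine Finset.sum_eq_zero fun i _ => ?_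
    rw [inner_sum]
    refine Finset.sum_eq_zero fun j _ => ?_
    have h3 : inner ℝ t (secondDeriv K f α (stdVec i) (stdVec j)) = (0 : ℝ) :=
      congrFun (congrFun h0 i) j
    rw [inner_smul_right, h3, mul_zero]
  exact ht (inner_self_eq_zero.mp h2)

/-- A graph over a rectangle is of strong Khinchin type for convergence if almost everywhere all
the quadratic forms `t · f''`, `t ≠ 0`, have rank at least `ρ`, where `2m + ρ < ρ (d + m)`. -/
theorem isStrongKhinchinConvergence_graphOver {d m ρ : ℕ} (hm : 0 < m)
    (hρ : 2 * m + ρ < ρ * (d + m)) {a b : Fin d → ℝ} (hab : ∀ i, a i < b i)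
    {f : EuclideanSpace ℝ (Fin d) → EuclideanSpace ℝ (Fin m)}
    (hf : ContDiffOn ℝ 2 f (closedRect a b))
    (hrank : ∀ᵐ α ∂(volume.restrict (closedRect a b)), ∀ t : EuclideanSpace ℝ (Fin m), t ≠ 0 →
      ρ ≤ (dotSecondDeriv (closedRect a b) f α t).rank) :
    IsStrongKhinchinConvergence d (graphOver (closedRect a b) f) := by
  intro ψ hψ θ
  set S : Set (Fin d → ℝ) := {α | ∃ᶠ q in Filter.atTop,
    α ∈ closeSet (fun β j => f (WithLp.toLp 2 β) j)
      (fun i => θ (Fin.castAdd m i)) (fun j => θ (Fin.natAdd d j)) q (ψ q)} with hS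
  have hK : ∀ α : Fin d → ℝ, α ∈ Set.Icc a b ↔ WithLp.toLp 2 α ∈ closedRect a b := fun α =>
    ⟨fun h i => ⟨h.1 i, h.2 i⟩, fun h => ⟨fun i => (h i).1, fun i => (h i).2⟩⟩
  have hbad : ∀ᵐ α : Fin d → ℝ, α ∈ Set.Icc a b → ∀ t : EuclideanSpace ℝ (Fin m), t ≠ 0 →
      ρ ≤ (dotSecondDeriv (closedRect a b) f (WithLp.toLp 2 α) t).rank := by
    rw [ae_restrict_iff' (isClosed_closedRect a b).measurableSet] at hrank
    filter_upwards [(PiLp.volume_preserving_toLp (Fin d)).quasiMeasurePreserving.ae hrank]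
      with α hα hαK
    exact hα ((hK α).mp hαK)
  have hbdry : ∀ᵐ α : Fin d → ℝ, α ∈ Set.Icc a b → ∀ i, a i < α i ∧ α i < b i := by
    have h1 := Measure.univ_pi_Ioo_ae_eq_Icc (μ := fun _ : Fin d => (volume : Measure ℝ))
      (f := a) (g := b)
    filter_upwards [h1.mem_iff] with α hα hαK i
    exact hα.mpr hαK i (Set.mem_univ i)
  have hgood : volume {α | α ∈ S ∧ (∀ i, a i < α i ∧ α i < b i) ∧
      ∀ t : EuclideanSpace ℝ (Fin m), t ≠ 0 →
        ρ ≤ (dotSecondDeriv (closedRect a b) f (WithLp.toLp 2 α) t).rank} = 0 := by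
    -- The radius depends on the good point, but a locally null set is null by second countability.
    refine measure_null_of_locally_null _ ?_
    rintro α0 ⟨-, hint, hr⟩
    have hnhds : closedRect a b ∈ nhds (WithLp.toLp 2 α0 : EuclideanSpace ℝ (Fin d)) :=
      closedRect_mem_nhds hint
    obtain ⟨r, hr0, hvol⟩ := exists_volume_limsup_closeSet_eq_zero_of_contDiffAt hm hρ
      (hf.contDiffAt hnhds) (fun t ht => by
        have := hr t ht
        rwa [dotSecondDeriv, secondDeriv_eq_of_mem_nhds f hnhds] at this) hψ
      (fun i => θ (Fin.castAdd m i)) (fun j => θ (Fin.natAdd d j))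
    refine ⟨_, Filter.inter_mem self_mem_nhdsWithin
      (mem_nhdsWithin_of_mem_nhds (Metric.ball_mem_nhds α0 hr0)), measure_mono_null ?_ hvol⟩
    rintro α ⟨hα, hαr⟩
    exact ⟨hα.1, hαr⟩
  have hnull : volume (S ∩ Set.Icc a b) = 0 := by
    refine measure_eq_zero_iff_ae_notMem.mpr ?_
    filter_upwards [hbad, hbdry, measure_eq_zero_iff_ae_notMem.mp hgood] with α h1 h2 h3 h4
    exact h3 ⟨h4.1, h2 h4.2, h1 h4.2⟩
  obtain ⟨C, hC⟩ := exists_lipschitzOnWith_closedRect hab hf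
  have hC' : LipschitzOnWith C f (WithLp.toLp 2 '' Set.Icc a b) := by
    refine hC.mono ?_
    rintro _ ⟨α, hα, rfl⟩
    exact (hK α).mp hα
  refine measure_mono_null ?_
    (hausdorffMeasure_image_graph_eq_zero Set.inter_subset_right hnull hC')
  rintro x ⟨hx, α, hα, rfl⟩
  exact ⟨fun i => α i, ⟨mem_closeSet_of_append_mem_approxSet hx, (hK _).mpr hα⟩, rfl⟩

end KhinchinType

theorem theorem1p3 (d m : ℕ) (hd : 0 < d) (hm : 0 < m)
    (a b : Fin d → ℝ) (hab : ∀ i, a i < b i)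
    (f : EuclideanSpace ℝ (Fin d) → EuclideanSpace ℝ (Fin m))
    (hf : ContDiffOn ℝ 2 f (KhinchinType.closedRect a b))
    (h : (m + 1 < d ∧
          ∀ᵐ α ∂(volume.restrict (KhinchinType.closedRect a b)),
            Function.Surjective
              (KhinchinType.secondDerivSym (KhinchinType.closedRect a b) f α)) ∨
        (m < (d + 1).choose 2 ∧
          ∀ᵐ α ∂(volume.restrict (KhinchinType.closedRect a b)),
            ∀ t : EuclideanSpace ℝ (Fin m), t ≠ 0 →
              2 ≤ (KhinchinType.dotSecondDeriv (KhinchinType.closedRect a b) f α t).rank)) :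
    KhinchinType.IsStrongKhinchinConvergence d
      (KhinchinType.graphOver (KhinchinType.closedRect a b) f) := by
  rcases h with ⟨hmd, h⟩ | ⟨hmd, h⟩
  · refine KhinchinType.isStrongKhinchinConvergence_graphOver (ρ := 1) hm (by omega) hab hf ?_
    filter_upwards [h] with α hα t ht
    exact KhinchinType.one_le_rank_dotSecondDeriv hα ht
  -- For d = 1 the binomial coefficient is 1, which contradicts m ≥ 1. With ρ = 2 the numerical
  -- condition is just d ≥ 2.
  · have hd2 : 2 ≤ d := by
      by_contra hlt
      have hd1 : d = 1 := by omega
      subst hd1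
      simp at hmd
      omega
    exact KhinchinType.isStrongKhinchinConvergence_graphOver (ρ := 2) hm (by omega) hab hf h
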